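/- Over $\mathsf{RCA}_0$, Fraïssé's conjecture (for arbitrary countable linear orders) implies arithmetical comprehension. In terms of models (which, by the completeness theorem, amounts to provability in $\mathsf{RCA}_0$): let $(M,\mathcal S,0,1,+,\cdot,<)$ be any structure for the two-sorted language of second-order arithmetic, with number domain $M$ (possibly nonstandard) and a nonempty family $\mathcal S\subseteq\mathcal P(M)$ as range of the set variables, that satisfies $\mathsf{RCA}_0$ (the basic axioms of arithmetic, $\Sigma^0_1$-induction and $\Delta^0_1$-comprehension, both with number and set parameters). Suppose that Fraïssé's conjecture holds in it: for every sequence $(L_i)_{i\in M}$ of linear orders on subsets of $M$ that is coded by a set in $\mathcal S$, there are $i<j$ in $M$ and a set in $\mathcal S$ that codes a strictly order preserving map $L_i\to L_j$. Then arithmetical comprehension holds in it: for every formula $\varphi(n)$ without set quantifiers, with number parameters from $M$ and set parameters from $\mathcal S$, we have $\{n\in M : \varphi(n)\}\in\mathcal S$. Here $(a,b)$ is coded by the number $(a+b)^2+a$; a linear order is coded by the set $R$ of pairs $(a,b)$ with $a\le_R b$ (reflexive on its field, which is possibly finite or empty); a map is coded by its graph; and a set $L$ codes the sequence with entries $L_i=\{p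 : (p,i)\in L\}$. -/

import Mathlib

namespace SOArith

/-! ### The two-sorted language of second-order arithmetic and its structures -/

/-- A structure for the language of second-order arithmetic with number domain `M`: interpretations
of `0, 1, +, ·, <` on `M` and a nonempty collection `sets` of subsets of `M`, over which the set
variables range. Neither `M` nor `sets` has to be standard. Equality of numbers and membership are
interpreted as true equality and true membership. -/
class L2Structure (M : Type*) extends Zero M, One M, Add M, Mul M, LT M where
  sets : Set (Set M)
  sets_nonempty : sets.Nonempty

/-- Numerical terms; the number variables are indexed by `ℕ`. -/
inductive NumTerm : Type
  | var (x : ℕ) : NumTerm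
  | zero : NumTerm
  | one : NumTerm
  | add (s t : NumTerm) : NumTerm
  | mul (s t : NumTerm) : NumTerm

/-- The set of number variables that occur in a term. -/
def NumTerm.vars : NumTerm → Set ℕ
  | .var x => {x}
  | .zero => ∅
  | .one => ∅
  | .add s t => s.vars ∪ t.vars
  | .mul s t => s.vars ∪ t.vars

/-- Formulas of second-order arithmetic; number variables and set variables are two separate sorts,
each indexed by `ℕ`. -/
inductive L2Formula : Type
  | eq (s t : NumTerm) : L2Formula
  | lt (s t : NumTerm) : L2Formula
  | mem (t : NumTerm) (X : ℕ) : L2Formula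
  | neg (φ : L2Formula) : L2Formula
  | and (φ ψ : L2Formula) : L2Formula
  | or (φ ψ : L2Formula) : L2Formula
  | imp (φ ψ : L2Formula) : L2Formula
  | allNum (x : ℕ) (φ : L2Formula) : L2Formula
  | exNum (x : ℕ) (φ : L2Formula) : L2Formula
  | allSet (X : ℕ) (φ : L2Formula) : L2Formula
  | exSet (X : ℕ) (φ : L2Formula) : L2Formula

/-- `Σ⁰₀` formulas: all quantifiers are bounded number quantifiers `∀ x < t` or `∃ x < t`, where `t`
is a term in which `x` does not occur. Set variables may occur as parameters. -/
inductive L2Formula.IsSigma00 : L2Formula → Prop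
  | eq (s t : NumTerm) : IsSigma00 (.eq s t)
  | lt (s t : NumTerm) : IsSigma00 (.lt s t)
  | mem (t : NumTerm) (X : ℕ) : IsSigma00 (.mem t X)
  | neg {φ : L2Formula} : IsSigma00 φ → IsSigma00 (.neg φ)
  | and {φ ψ : L2Formula} : IsSigma00 φ → IsSigma00 ψ → IsSigma00 (.and φ ψ)
  | or {φ ψ : L2Formula} : IsSigma00 φ → IsSigma00 ψ → IsSigma00 (.or φ ψ)
  | imp {φ ψ : L2Formula} : IsSigma00 φ → IsSigma00 ψ → IsSigma00 (.imp φ ψ)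
  | ball {x : ℕ} {t : NumTerm} {φ : L2Formula} : x ∉ t.vars → IsSigma00 φ →
      IsSigma00 (.allNum x (.imp (.lt (.var x) t) φ))
  | bex {x : ℕ} {t : NumTerm} {φ : L2Formula} : x ∉ t.vars → IsSigma00 φ →
      IsSigma00 (.exNum x (.and (.lt (.var x) t) φ))

/-- `Σ⁰₁` formulas: `∃ x, θ` with `θ` in `Σ⁰₀`. -/
def L2Formula.IsSigma01 (φ : L2Formula) : Prop :=
  ∃ (x : ℕ) (θ : L2Formula), θ.IsSigma00 ∧ φ = .exNum x θ

/-- `Π⁰₁` formulas: `∀ x, θ` with `θ` in `Σ⁰₀`. -/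
def L2Formula.IsPi01 (φ : L2Formula) : Prop :=
  ∃ (x : ℕ) (θ : L2Formula), θ.IsSigma00 ∧ φ = .allNum x θ

/-- Arithmetical formulas: no set quantifiers (set variables may occur as parameters). -/
def L2Formula.IsArithmetical : L2Formula → Prop
  | .eq _ _ => True
  | .lt _ _ => True
  | .mem _ _ => True
  | .neg φ => φ.IsArithmetical
  | .and φ ψ => φ.IsArithmetical ∧ ψ.IsArithmetical
  | .or φ ψ => φ.IsArithmetical ∧ ψ.IsArithmetical
  | .imp φ ψ => φ.IsArithmetical ∧ ψ.IsArithmetical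
  | .allNum _ φ => φ.IsArithmetical
  | .exNum _ φ => φ.IsArithmetical
  | .allSet _ _ => False
  | .exSet _ _ => False

section Semantics

variable {M : Type*} [L2Structure M]

/-- The value of a term under an assignment `v` of the number variables. -/
def NumTerm.eval (v : ℕ → M) : NumTerm → M
  | .var x => v x
  | .zero => 0
  | .one => 1
  | .add s t => s.eval v + t.eval v
  | .mul s t => s.eval v * t.eval v

/-- Truth of a formula in the structure `M`, under an assignment `v` of the number variables and an
assignment `V` of the set variables. -/
def L2Formula.Realize : L2Formula → (ℕ → M) → (ℕ → L2Structure.sets (M := M)) → Prop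
  | .eq s t, v, _ => s.eval v = t.eval v
  | .lt s t, v, _ => s.eval v < t.eval v
  | .mem t X, v, V => t.eval v ∈ (V X : Set M)
  | .neg φ, v, V => ¬ φ.Realize v V
  | .and φ ψ, v, V => φ.Realize v V ∧ ψ.Realize v V
  | .or φ ψ, v, V => φ.Realize v V ∨ ψ.Realize v V
  | .imp φ ψ, v, V => φ.Realize v V → ψ.Realize v V
  | .allNum x φ, v, V => ∀ a : M, φ.Realize (Function.update v x a) V
  | .exNum x φ, v, V => ∃ a : M, φ.Realize (Function.update v x a) V
  | .allSet X φ, v, V => ∀ A : L2Structure.sets (M := M), φ.Realize v (Function.update V X A)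
  | .exSet X φ, v, V => ∃ A : L2Structure.sets (M := M), φ.Realize v (Function.update V X A)

end Semantics

/-! ### Axioms

The axiom schemes are the universal closures of their instances: the assignments `v` and `V` supply
arbitrary number and set parameters. -/

/-- The basic axioms of arithmetic. -/
structure BasicAxioms (M : Type*) [L2Structure M] : Prop where
  succ_ne_zero : ∀ n : M, n + 1 ≠ 0
  succ_inj : ∀ m n : M, m + 1 = n + 1 → m = n
  add_zero : ∀ m : M, m + 0 = m
  add_succ : ∀ m n : M, m + (n + 1) = (m + n) + 1
  mul_zero : ∀ m : M, m * 0 = 0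
  mul_succ : ∀ m n : M, m * (n + 1) = m * n + m
  not_lt_zero : ∀ m : M, ¬ m < 0
  lt_succ_iff : ∀ m n : M, m < n + 1 ↔ m < n ∨ m = n

/-- `Σ⁰₁` induction. -/
def Sigma01Induction (M : Type*) [L2Structure M] : Prop :=
  ∀ φ : L2Formula, φ.IsSigma01 →
    ∀ (x : ℕ) (v : ℕ → M) (V : ℕ → L2Structure.sets (M := M)),
      φ.Realize (Function.update v x 0) V →
      (∀ n : M, φ.Realize (Function.update v x n) V →
        φ.Realize (Function.update v x (n + 1)) V) →
      ∀ n : M, φ.Realize (Function.update v x n) V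

/-- `Δ⁰₁` comprehension (recursive comprehension). -/
def Delta01Comprehension (M : Type*) [L2Structure M] : Prop :=
  ∀ φ ψ : L2Formula, φ.IsSigma01 → ψ.IsPi01 →
    ∀ (x : ℕ) (v : ℕ → M) (V : ℕ → L2Structure.sets (M := M)),
      (∀ n : M, φ.Realize (Function.update v x n) V ↔ ψ.Realize (Function.update v x n) V) →
      ∃ A ∈ L2Structure.sets (M := M), ∀ n : M, n ∈ A ↔ φ.Realize (Function.update v x n) V

/-- `M` is a model of `RCA₀`. -/
structure IsModelRCA0 (M : Type*) [L2Structure M] : Prop where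
  basic : BasicAxioms M
  induction : Sigma01Induction M
  comprehension : Delta01Comprehension M

/-- `M` satisfies arithmetical comprehension. -/
def ArithmeticalComprehension (M : Type*) [L2Structure M] : Prop :=
  ∀ φ : L2Formula, φ.IsArithmetical →
    ∀ (x : ℕ) (v : ℕ → M) (V : ℕ → L2Structure.sets (M := M)),
      ∃ A ∈ L2Structure.sets (M := M), ∀ n : M, n ∈ A ↔ φ.Realize (Function.update v x n) V

/-! ### Fraïssé's conjecture inside a structure

All quantifiers below range over numbers of `M` and sets of `M`. -/

section Orders

variable {M : Type*} [L2Structure M]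

/-- The code `(a + b)² + a` of the pair `(a, b)`. -/
def pair (a b : M) : M := (a + b) * (a + b) + a

/-- The `i`-th entry of the sequence of sets coded by `L`. -/
def entry (L : Set M) (i : M) : Set M := {p | pair p i ∈ L}

/-- The field of a (reflexive) relation that is coded as a set of pairs. -/
def field (R : Set M) : Set M := {a | pair a a ∈ R}

/-- `R` codes a (non-strict) linear order on the set `field R` of numbers. The field may be finite,
and it may be empty. -/
structure IsLinOrder (R : Set M) : Prop where
  pairs : ∀ p ∈ R, ∃ a ∈ field R, ∃ b ∈ field R, p = pair a b
  antisymm : ∀ a b : M, pair a b ∈ R → pair b a ∈ R → a = b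
  trans : ∀ a b c : M, pair a b ∈ R → pair b c ∈ R → pair a c ∈ R
  total : ∀ a ∈ field R, ∀ b ∈ field R, pair a b ∈ R ∨ pair b a ∈ R

/-- The strict part of the order coded by `R`. -/
def slt (R : Set M) (a b : M) : Prop := pair a b ∈ R ∧ a ≠ b

/-- `F` codes the graph of a function from `field R` to `field Q` that preserves the strict
orders. -/
structure IsEmbedding (F R Q : Set M) : Prop where
  pairs : ∀ p ∈ F, ∃ a ∈ field R, ∃ b ∈ field Q, p = pair a b
  function : ∀ a ∈ field R, ∃! b : M, pair a b ∈ F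
  strictMono : ∀ a b c d : M, pair a c ∈ F → pair b d ∈ F → slt R a b → slt Q c d

/-- The linear order coded by `R` embeds into the one coded by `Q`, by an embedding in `M`. -/
def Embeds (R Q : Set M) : Prop := ∃ F ∈ L2Structure.sets (M := M), IsEmbedding F R Q

end Orders

/-- `M` satisfies Fraïssé's conjecture: for every sequence `L₀, L₁, …` of (countable) linear orders
that is coded in `M`, there are numbers `i < j` such that `Lᵢ` embeds into `Lⱼ`. -/
def FraisseConjecture (M : Type*) [L2Structure M] : Prop :=
  ∀ L ∈ L2Structure.sets (M := M), (∀ i : M, IsLinOrder (entry L i)) →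
    ∃ i j : M, i < j ∧ Embeds (entry L i) (entry L j)

end SOArith

namespace SOArith

open Function

/-! ### Comprehension and induction for `Σ⁰₀` formulas -/

/-! It suffices that the range of every injection `f` in the model belongs to the model. Each Σ⁰₁
set reduces to such a range, so decidable predicates are closed under number quantifiers
(`RecP.ex`), and arithmetical comprehension follows by induction on formulas
(`L2Formula.recP_realize`).

Call a stage `a` true if `f a < f l` for all `l > a`. An unbounded set of true stages in the model
decides the range: if `a` is true, every value below `f a` is taken by stage `a`. Order the stages
so that a later `b` lies below `a` exactly when `a` still appears true at `b`. Then a true stage has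
all later stages below it, a false one only boundedly many. Replace each stage `m` by a finite block
of nodes `(m, k)` with `k ≤ m`, decreasing in `k`, and let the `i`-th order consist of the nodes
with `k > i`. These orders shrink as `i` grows.

Fraïssé's conjecture embeds the `i`-th order into the `j`-th for some `i < j`. If `t` minimizes `f`
from `j` on, the node `(t, j)` of the `i`-th order lies above the entire `j`-th order
(`nodeLe_of_isNode`), so the embedding moves it down. The set of nodes that are moved down is closed
under the embedding, hence has unboundedly many elements below each of its members
(`exists_large_descending`). So the stages of these nodes are true, and the set, which is in the
model, decides the range of `f` (`range_mem_sets`).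

To stay within `RCA₀`, `RecP` and `Rec` replace explicit formulas by closure properties of decidable
predicates and computable functions. -/

theorem NumTerm.exists_fresh {M : Type*} [L2Structure M] (t : NumTerm) :
    ∃ N : ℕ, ∀ y ≥ N, ∀ (v : ℕ → M) (a : M), t.eval (update v y a) = t.eval v := by
  induction t with
  | var x =>
    exact ⟨x + 1, fun y hy v a => update_of_ne (by omega) _ _⟩
  | zero => exact ⟨0, fun _ _ _ _ => rfl⟩
  | one => exact ⟨0, fun _ _ _ _ => rfl⟩
  | add s t hs ht =>
    obtain ⟨m, hm⟩ := hs
    obtain ⟨n, hn⟩ := ht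
    refine ⟨max m n, fun y hy v a => ?_⟩
    simp only [NumTerm.eval, hm y (le_of_max_le_left hy), hn y (le_of_max_le_right hy)]
  | mul s t hs ht =>
    obtain ⟨m, hm⟩ := hs
    obtain ⟨n, hn⟩ := ht
    refine ⟨max m n, fun y hy v a => ?_⟩
    simp only [NumTerm.eval, hm y (le_of_max_le_left hy), hn y (le_of_max_le_right hy)]

/-- An index that is irrelevant to truth allows a dummy quantifier, by which a Σ⁰₀ formula counts as
both Σ⁰₁ and Π⁰₁. -/
theorem L2Formula.exists_fresh {M : Type*} [L2Structure M] (φ : L2Formula) :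
    ∃ N : ℕ, ∀ y ≥ N, ∀ (v : ℕ → M) (V : ℕ → L2Structure.sets (M := M)) (a : M),
      φ.Realize (update v y a) V ↔ φ.Realize v V := by
  induction φ with
  | eq s t | lt s t =>
    obtain ⟨m, hm⟩ := s.exists_fresh (M := M)
    obtain ⟨n, hn⟩ := t.exists_fresh (M := M)
    refine ⟨max m n, fun y hy v V a => ?_⟩
    simp only [Realize, hm y (le_of_max_le_left hy), hn y (le_of_max_le_right hy)]
  | mem t X =>
    obtain ⟨n, hn⟩ := t.exists_fresh (M := M)
    exact ⟨n, fun y hy v V a => by simp only [Realize, hn y hy]⟩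
  | neg φ h =>
    obtain ⟨n, hn⟩ := h
    exact ⟨n, fun y hy v V a => by simp only [Realize, hn y hy]⟩
  | and φ ψ hφ hψ | or φ ψ hφ hψ | imp φ ψ hφ hψ =>
    obtain ⟨m, hm⟩ := hφ
    obtain ⟨n, hn⟩ := hψ
    refine ⟨max m n, fun y hy v V a => ?_⟩
    simp only [Realize, hm y (le_of_max_le_left hy), hn y (le_of_max_le_right hy)]
  | allNum x φ h | exNum x φ h =>
    obtain ⟨n, hn⟩ := h
    refine ⟨max n (x + 1), fun y hy v V a => ?_⟩
    have hyx : x ≠ y := by have := le_of_max_le_right hy; omega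
    simp only [Realize, update_comm hyx.symm, hn y (le_of_max_le_left hy)]
  | allSet X φ h | exSet X φ h =>
    obtain ⟨n, hn⟩ := h
    exact ⟨n, fun y hy v V a => by simp only [Realize, hn y hy]⟩

/-- The assignment of `a` and `b` to the number variables `1` and `2`, and of `c` to the others. -/
def assign {M : Type*} (a b c : M) : ℕ → M
  | 1 => a
  | 2 => b
  | _ => c

@[simp] theorem assign_one {M : Type*} (a b c : M) : assign a b c 1 = a := rfl

@[simp] theorem assign_two {M : Type*} (a b c : M) : assign a b c 2 = b := rfl

section Model

variable {M : Type*} [L2Structure M] [hM : Fact (IsModelRCA0 M)]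

theorem sigma01_induction {θ : L2Formula} (hθ : θ.IsSigma00) (x y : ℕ) (v : ℕ → M)
    (V : ℕ → L2Structure.sets (M := M))
    (zero : ∃ a, θ.Realize (update (update v x 0) y a) V)
    (succ : ∀ n, (∃ a, θ.Realize (update (update v x n) y a) V) →
      ∃ a, θ.Realize (update (update v x (n + 1)) y a) V) (n : M) :
    ∃ a, θ.Realize (update (update v x n) y a) V :=
  hM.out.induction (.exNum y θ) ⟨y, θ, hθ, rfl⟩ x v V zero succ n

theorem sigma00_induction {θ : L2Formula} (hθ : θ.IsSigma00) (x : ℕ) (v : ℕ → M)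
    (V : ℕ → L2Structure.sets (M := M)) (zero : θ.Realize (update v x 0) V)
    (succ : ∀ n, θ.Realize (update v x n) V → θ.Realize (update v x (n + 1)) V) (n : M) :
    θ.Realize (update v x n) V := by
  obtain ⟨N, hN⟩ := θ.exists_fresh (M := M)
  have := sigma01_induction hθ x N v V
  simp only [hN N le_rfl, exists_const] at this
  exact this zero succ n

theorem delta01_comprehension {θ η : L2Formula} (hθ : θ.IsSigma00) (hη : η.IsSigma00) (x y : ℕ)
    (v : ℕ → M) (V : ℕ → L2Structure.sets (M := M))
    (h : ∀ n, (∃ a, θ.Realize (update (update v x n) y a) V) ↔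
      ∀ a, η.Realize (update (update v x n) y a) V) :
    {n | ∃ a, θ.Realize (update (update v x n) y a) V} ∈ L2Structure.sets (M := M) := by
  obtain ⟨A, hA, hAn⟩ := hM.out.comprehension (.exNum y θ) (.allNum y η) ⟨y, θ, hθ, rfl⟩
    ⟨y, η, hη, rfl⟩ x v V h
  convert hA using 1
  exact Set.ext fun n => (hAn n).symm

theorem sigma00_comprehension {θ : L2Formula} (hθ : θ.IsSigma00) (x : ℕ)
    (v : ℕ → M) (V : ℕ → L2Structure.sets (M := M)) :
    {n | θ.Realize (update v x n) V} ∈ L2Structure.sets (M := M) := by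
  obtain ⟨N, hN⟩ := θ.exists_fresh (M := M)
  have := delta01_comprehension hθ hθ x N v V
  simp only [hN N le_rfl, exists_const, forall_const] at this
  exact this

/-! ### Arithmetic in a model -/

theorem sets_univ : (Set.univ : Set M) ∈ L2Structure.sets (M := M) := by
  -- The formula has no set variable, but an assignment is still needed; this is where nonemptiness
  -- of the family of sets enters.
  have := sigma00_comprehension (.eq .zero .zero) 0 (fun _ => (0 : M))
    (fun _ => ⟨_, L2Structure.sets_nonempty.some_mem⟩)
  simpa [L2Formula.Realize] using this

/-- The assignment of `A` and `B` to the set variables `0` and `1`, and of `C` to the others. -/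
def setAssign (A B C : L2Structure.sets (M := M)) : ℕ → L2Structure.sets (M := M)
  | 0 => A
  | 1 => B
  | _ => C

/-- The assignment with all set variables interpreted by the set of all numbers. -/
def univAssign : ℕ → L2Structure.sets (M := M) := fun _ => ⟨Set.univ, sets_univ⟩

theorem eq_induction (s t : NumTerm) (a b c : M)
    (zero : s.eval (update (assign a b c) 0 0) = t.eval (update (assign a b c) 0 0))
    (succ : ∀ n, s.eval (update (assign a b c) 0 n) = t.eval (update (assign a b c) 0 n) →
      s.eval (update (assign a b c) 0 (n + 1)) = t.eval (update (assign a b c) 0 (n + 1))) (n : M) :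
    s.eval (update (assign a b c) 0 n) = t.eval (update (assign a b c) 0 n) :=
  sigma00_induction (.eq s t) 0 (assign a b c) univAssign zero succ n

/-! ### Semiring and order laws by induction -/

namespace Arith

theorem add_zero (a : M) : a + 0 = a := hM.out.basic.add_zero a

theorem add_succ (a b : M) : a + (b + 1) = a + b + 1 := hM.out.basic.add_succ a b

theorem mul_zero (a : M) : a * 0 = 0 := hM.out.basic.mul_zero a

theorem mul_succ (a b : M) : a * (b + 1) = a * b + a := hM.out.basic.mul_succ a b

theorem zero_add (a : M) : 0 + a = a := by
  have := eq_induction (.add .zero (.var 0)) (.var 0) a a a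
  simp only [NumTerm.eval, update_self] at this
  exact this (add_zero 0) (fun n h => by rw [add_succ, h]) a

theorem succ_add (a b : M) : a + 1 + b = a + b + 1 := by
  have := eq_induction (.add (.add (.var 1) .one) (.var 0)) (.add (.add (.var 1) (.var 0)) .one)
    a a a
  simp only [NumTerm.eval, update_self, ne_eq, one_ne_zero, not_false_eq_true, update_of_ne,
    assign_one] at this
  exact this (by rw [add_zero, add_zero]) (fun n h => by rw [add_succ, h, add_succ]) b

theorem add_comm (a b : M) : a + b = b + a := by
  have := eq_induction (.add (.var 1) (.var 0)) (.add (.var 0) (.var 1)) a a a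
  simp only [NumTerm.eval, update_self, ne_eq, one_ne_zero, not_false_eq_true, update_of_ne,
    assign_one] at this
  exact this (by rw [add_zero, zero_add]) (fun n h => by rw [add_succ, h, succ_add]) b

theorem add_assoc (a b c : M) : a + b + c = a + (b + c) := by
  have := eq_induction (.add (.add (.var 1) (.var 2)) (.var 0))
    (.add (.var 1) (.add (.var 2) (.var 0))) a b a
  simp only [NumTerm.eval, update_self, ne_eq, one_ne_zero, OfNat.ofNat_ne_zero, not_false_eq_true,
    update_of_ne, assign_one, assign_two] at this
  exact this (by rw [add_zero, add_zero]) (fun n h => by rw [add_succ, h, add_succ, add_succ]) c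

theorem zero_mul (a : M) : 0 * a = 0 := by
  have := eq_induction (.mul .zero (.var 0)) .zero a a a
  simp only [NumTerm.eval, update_self] at this
  exact this (mul_zero 0) (fun n h => by rw [mul_succ, h, add_zero]) a

theorem succ_mul (a b : M) : (a + 1) * b = a * b + b := by
  have := eq_induction (.mul (.add (.var 1) .one) (.var 0))
    (.add (.mul (.var 1) (.var 0)) (.var 0)) a a a
  simp only [NumTerm.eval, update_self, ne_eq, one_ne_zero, not_false_eq_true, update_of_ne,
    assign_one] at this
  refine this (by rw [mul_zero, mul_zero, add_zero]) (fun n h => ?_) b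
  rw [mul_succ, h, mul_succ, ← add_assoc, ← add_assoc, add_assoc (a * n) n a, add_comm n a,
    ← add_assoc]

theorem mul_comm (a b : M) : a * b = b * a := by
  have := eq_induction (.mul (.var 1) (.var 0)) (.mul (.var 0) (.var 1)) a a a
  simp only [NumTerm.eval, update_self, ne_eq, one_ne_zero, not_false_eq_true, update_of_ne,
    assign_one] at this
  exact this (by rw [mul_zero, zero_mul]) (fun n h => by rw [mul_succ, h, succ_mul]) b

theorem mul_add (a b c : M) : a * (b + c) = a * b + a * c := by
  have := eq_induction (.mul (.var 1) (.add (.var 2) (.var 0)))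
    (.add (.mul (.var 1) (.var 2)) (.mul (.var 1) (.var 0))) a b a
  simp only [NumTerm.eval, update_self, ne_eq, one_ne_zero, OfNat.ofNat_ne_zero, not_false_eq_true,
    update_of_ne, assign_one, assign_two] at this
  exact this (by rw [add_zero, mul_zero, add_zero])
    (fun n h => by rw [add_succ, mul_succ, h, mul_succ, add_assoc]) c

theorem mul_assoc (a b c : M) : a * b * c = a * (b * c) := by
  have := eq_induction (.mul (.mul (.var 1) (.var 2)) (.var 0))
    (.mul (.var 1) (.mul (.var 2) (.var 0))) a b a
  simp only [NumTerm.eval, update_self, ne_eq, one_ne_zero, OfNat.ofNat_ne_zero, not_false_eq_true,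
    update_of_ne, assign_one, assign_two] at this
  exact this (by rw [mul_zero, mul_zero, mul_zero])
    (fun n h => by rw [mul_succ, h, mul_succ, mul_add]) c

theorem mul_one (a : M) : a * 1 = a := by
  rw [← zero_add (1 : M), mul_succ, mul_zero, zero_add]

theorem add_right_cancel (a b c : M) (h : a + c = b + c) : a = b := by
  have := sigma00_induction (M := M)
    (.imp (.eq (.add (.var 1) (.var 0)) (.add (.var 2) (.var 0))) (.eq (.var 1) (.var 2)))
    0 (assign a b a) univAssign
  simp only [L2Formula.Realize, NumTerm.eval, update_self, ne_eq, one_ne_zero,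
    OfNat.ofNat_ne_zero, not_false_eq_true, update_of_ne, assign_one, assign_two] at this
  refine this (by rw [add_zero, add_zero]; exact id) (fun n h h' => h ?_) c h
  rw [add_succ, add_succ] at h'
  exact hM.out.basic.succ_inj _ _ h'

theorem lt_succ_iff (a b : M) : a < b + 1 ↔ a < b ∨ a = b := hM.out.basic.lt_succ_iff a b

theorem not_lt_zero (a : M) : ¬ a < 0 := hM.out.basic.not_lt_zero a

theorem lt_add_succ (a c : M) : a < a + c + 1 := by
  have := sigma00_induction (M := M)
    (.lt (.var 1) (.add (.add (.var 1) (.var 0)) .one))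
    0 (assign a a a) univAssign
  simp only [L2Formula.Realize, NumTerm.eval, update_self, ne_eq, one_ne_zero,
    not_false_eq_true, update_of_ne, assign_one] at this
  refine this ?_ (fun n h => ?_) c
  · rw [add_zero, lt_succ_iff]; exact .inr rfl
  · rw [lt_succ_iff, add_succ]; exact .inl h

theorem exists_of_lt (a b : M) (h : a < b) : ∃ c, b = a + c + 1 := by
  -- The hypothesis `a < n` stays inside the existential quantifier, so that the induction formula
  -- is Σ⁰₁.
  have := sigma01_induction (M := M)
    (.imp (.lt (.var 1) (.var 0)) (.eq (.var 0) (.add (.add (.var 1) (.var 2)) .one)))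
    0 2 (assign a a a) univAssign
  simp only [L2Formula.Realize, NumTerm.eval, update_self, ne_eq, one_ne_zero,
    OfNat.zero_ne_ofNat, not_false_eq_true, update_of_ne, assign_one,
    OfNat.one_ne_ofNat] at this
  refine (this ⟨0, fun h => (not_lt_zero _ h).elim⟩ (fun n ⟨c, h⟩ => ?_) b).imp fun c hc => hc h
  by_cases han : a < n
  · exact ⟨c + 1, fun _ => by rw [add_succ, ← h han]⟩
  · refine ⟨0, fun h' => ?_⟩
    rw [((lt_succ_iff _ _).1 h').resolve_left han, add_zero]

theorem exists_add_total (a b : M) : ∃ c, a + c = b ∨ b + c = a := by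
  have := sigma01_induction (M := M)
    (.or (.eq (.add (.var 1) (.var 2)) (.var 0)) (.eq (.add (.var 0) (.var 2)) (.var 1)))
    0 2 (assign a a a) univAssign
  simp only [L2Formula.Realize, NumTerm.eval, update_self, ne_eq, one_ne_zero,
    OfNat.zero_ne_ofNat, not_false_eq_true, update_of_ne, assign_one,
    OfNat.one_ne_ofNat] at this
  refine this ⟨a, .inr (zero_add a)⟩ (fun n ⟨c, h⟩ => ?_) b
  rcases h with h | h
  · exact ⟨c + 1, .inl (by rw [add_succ, h])⟩
  · by_cases hna : n < a
    · obtain ⟨d, rfl⟩ := exists_of_lt _ _ hna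
      exact ⟨d, .inr (succ_add _ _)⟩
    -- Here `n + c = a` without `n < a` forces `c = 0`, so `n = a` and the next number is `a + 1`.
    · refine ⟨1, .inl ?_⟩
      by_cases hc : 0 < c
      · obtain ⟨d, rfl⟩ := exists_of_lt _ _ hc
        exact (hna (h ▸ by rw [add_succ]; exact lt_add_succ _ _)).elim
      · have hc0 : c = 0 := by
          have : (0 : M) < c + 1 := by
            have := lt_add_succ (0 : M) c
            rwa [zero_add] at this
          exact (((lt_succ_iff _ _).1 this).resolve_left hc).symm
        rw [← h, hc0, add_zero]

end Arith

instance : CommSemiring M where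
  add_assoc := Arith.add_assoc
  zero_add := Arith.zero_add
  add_zero := Arith.add_zero
  nsmul := nsmulRec
  add_comm := Arith.add_comm
  left_distrib := Arith.mul_add
  right_distrib a b c := by
    rw [Arith.mul_comm, Arith.mul_add, Arith.mul_comm c a, Arith.mul_comm c b]
  zero_mul := Arith.zero_mul
  mul_zero := Arith.mul_zero
  mul_assoc := Arith.mul_assoc
  one_mul a := by rw [Arith.mul_comm, Arith.mul_one]
  mul_one := Arith.mul_one
  npow n a := Nat.rec 1 (fun _ b => b * a) n
  npow_zero _ := rfl
  npow_succ _ _ := rfl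
  mul_comm := Arith.mul_comm

theorem lt_iff_exists_add_succ {a b : M} : a < b ↔ ∃ c, b = a + c + 1 :=
  ⟨Arith.exists_of_lt a b, fun ⟨c, h⟩ => h ▸ Arith.lt_add_succ a c⟩

theorem Arith.lt_trans (a b c : M) (hab : a < b) (hbc : b < c) : a < c := by
  rw [lt_iff_exists_add_succ] at *
  obtain ⟨d, rfl⟩ := hab
  obtain ⟨e, rfl⟩ := hbc
  exact ⟨d + 1 + e, by ring⟩

theorem Arith.lt_irrefl (a : M) : ¬ a < a := by
  rw [lt_iff_exists_add_succ]
  rintro ⟨c, h⟩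
  refine hM.out.basic.succ_ne_zero c (Arith.add_right_cancel _ _ a ?_)
  rw [_root_.zero_add, _root_.add_comm, ← _root_.add_assoc]
  exact h.symm

theorem eq_zero_or_succ (a : M) : a = 0 ∨ ∃ b, a = b + 1 := by
  have : (0 : M) < a + 1 := lt_iff_exists_add_succ.2 ⟨a, by ring⟩
  rcases (Arith.lt_succ_iff _ _).1 this with h | h
  · obtain ⟨c, rfl⟩ := lt_iff_exists_add_succ.1 h
    exact .inr ⟨c, by ring⟩
  · exact .inl h.symm

theorem Arith.trichotomy (a b : M) : a < b ∨ a = b ∨ b < a := by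
  obtain ⟨c, h | h⟩ := Arith.exists_add_total a b <;>
  obtain rfl | ⟨d, rfl⟩ := eq_zero_or_succ c
  · exact .inr (.inl (by simpa using h))
  · exact .inl (lt_iff_exists_add_succ.2 ⟨d, by rw [← h]; ring⟩)
  · exact .inr (.inl (by simpa using h.symm))
  · exact .inr (.inr (lt_iff_exists_add_succ.2 ⟨d, by rw [← h]; ring⟩))

open Classical in
noncomputable instance : LinearOrder M where
  le a b := a < b ∨ a = b
  lt := (· < ·)
  le_refl a := .inr rfl
  le_trans a b c := by
    rintro (h | rfl) (h' | rfl)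
    exacts [.inl (Arith.lt_trans _ _ _ h h'), .inl h, .inl h', .inr rfl]
  lt_iff_le_not_ge a b := by
    constructor
    · intro h
      refine ⟨.inl h, ?_⟩
      rintro (h' | rfl)
      exacts [Arith.lt_irrefl _ (Arith.lt_trans _ _ _ h h'), Arith.lt_irrefl _ h]
    · rintro ⟨h | rfl, h'⟩
      exacts [h, (h' (.inr rfl)).elim]
  le_antisymm a b := by
    rintro (h | rfl) (h' | h')
    exacts [(Arith.lt_irrefl _ (Arith.lt_trans _ _ _ h h')).elim, h'.symm, rfl, rfl]
  le_total a b := by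
    rcases Arith.trichotomy a b with h | h | h
    exacts [.inl (.inl h), .inl (.inr h), .inr (.inl h)]
  toDecidableLE := fun _ _ => propDecidable _

theorem lt_add_one_iff {a b : M} : a < b + 1 ↔ a ≤ b := Arith.lt_succ_iff a b

theorem le_iff_exists_add {a b : M} : a ≤ b ↔ ∃ c, b = a + c := by
  rw [← lt_add_one_iff, lt_iff_exists_add_succ]
  constructor
  · rintro ⟨c, h⟩
    exact ⟨c, hM.out.basic.succ_inj _ _ h⟩
  · rintro ⟨c, rfl⟩
    exact ⟨c, rfl⟩

theorem zero_lt_one_model : (0 : M) < 1 := lt_iff_exists_add_succ.2 ⟨0, by ring⟩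

instance : IsStrictOrderedRing M where
  add_le_add_left a b h c := by
    obtain ⟨d, rfl⟩ := le_iff_exists_add.1 h
    exact le_iff_exists_add.2 ⟨d, by ring⟩
  le_of_add_le_add_left a b c h := by
    obtain ⟨d, hd⟩ := le_iff_exists_add.1 h
    refine le_iff_exists_add.2 ⟨d, Arith.add_right_cancel _ _ a ?_⟩
    rw [add_comm, hd]; ring
  zero_le_one := zero_lt_one_model.le
  exists_pair_ne := ⟨0, 1, zero_lt_one_model.ne⟩
  mul_lt_mul_of_pos_left _ ha _ c h := by
    obtain ⟨d, rfl⟩ := lt_iff_exists_add_succ.1 ha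
    obtain ⟨e, rfl⟩ := lt_iff_exists_add_succ.1 h
    exact lt_iff_exists_add_succ.2 ⟨d * e + e + d, by ring⟩
  mul_lt_mul_of_pos_right _ ha _ c h := by
    obtain ⟨d, rfl⟩ := lt_iff_exists_add_succ.1 ha
    obtain ⟨e, rfl⟩ := lt_iff_exists_add_succ.1 h
    exact lt_iff_exists_add_succ.2 ⟨d * e + e + d, by ring⟩

instance : CanonicallyOrderedAdd M where
  exists_add_of_le h := le_iff_exists_add.1 h
  le_self_add _ b := le_iff_exists_add.2 ⟨b, rfl⟩
  le_add_self _ b := le_iff_exists_add.2 ⟨b, add_comm _ _⟩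

/-! ### Pairing -/

theorem add_one_le_iff {a b : M} : a + 1 ≤ b ↔ a < b := by
  rw [← not_lt, lt_add_one_iff, not_le]

theorem le_mul_self (a : M) : a ≤ a * a := by
  obtain rfl | ⟨b, rfl⟩ := eq_zero_or_succ a
  · simp
  · exact le_iff_exists_add.2 ⟨(b + 1) * b, by ring⟩

theorem left_le_pair (a b : M) : a ≤ pair a b := le_add_self

theorem right_le_pair (a b : M) : b ≤ pair a b :=
  le_add_self.trans ((le_mul_self (a + b)).trans le_self_add)

/-- The remainder `a` is too small to reach the next square, so the sum of the components can be
read off the code. -/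
theorem pair_lt_of_add_lt {a b c d : M} (h : a + b < c + d) : pair a b < pair c d := by
  obtain ⟨e, he⟩ := lt_iff_exists_add_succ.1 h
  -- With `s = a + b`, the witness is `(s + e + 1)² + c - s² - a - 1`, expanded so that no
  -- subtraction remains.
  refine lt_iff_exists_add_succ.2 ⟨2 * (a + b) * e + a + 2 * b + 2 * e + e * e + c, ?_⟩
  simp only [pair, he]
  ring

theorem pair_inj {a b c d : M} : pair a b = pair c d ↔ a = c ∧ b = d := by
  refine ⟨fun h => ?_, fun ⟨h, h'⟩ => by rw [h, h']⟩
  have hs : a + b = c + d := by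
    rcases lt_trichotomy (a + b) (c + d) with h' | h' | h'
    · exact ((pair_lt_of_add_lt h').ne h).elim
    · exact h'
    · exact ((pair_lt_of_add_lt h').ne h.symm).elim
  simp only [pair, hs, add_right_inj] at h
  subst h
  exact ⟨rfl, by simpa using hs⟩

theorem pair_mono {a b c d : M} (h : a ≤ c) (h' : b ≤ d) : pair a b ≤ pair c d := by
  unfold pair; gcongr

end Model

open L2Formula

/-! ### Formulas with pairs and bounded quantifiers -/

/-- The term `(s + t)² + s`. -/
def NumTerm.pair (s t : NumTerm) : NumTerm := .add (.mul (.add s t) (.add s t)) s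

/-- The formula `∃ x ≤ y, φ`. -/
def L2Formula.bex (x y : ℕ) (φ : L2Formula) : L2Formula :=
  .exNum x (.and (.lt (.var x) (.add (.var y) .one)) φ)

/-- The formula `∀ x ≤ y, φ`. -/
def L2Formula.ball (x y : ℕ) (φ : L2Formula) : L2Formula :=
  .allNum x (.imp (.lt (.var x) (.add (.var y) .one)) φ)

theorem L2Formula.IsSigma00.bexVar (x y : ℕ) {φ : L2Formula} (hφ : φ.IsSigma00)
    (h : x ≠ y := by decide) : (L2Formula.bex x y φ).IsSigma00 :=
  .bex (by simpa [NumTerm.vars] using h) hφ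

theorem L2Formula.IsSigma00.ballVar (x y : ℕ) {φ : L2Formula} (hφ : φ.IsSigma00)
    (h : x ≠ y := by decide) : (L2Formula.ball x y φ).IsSigma00 :=
  .ball (by simpa [NumTerm.vars] using h) hφ

/-! ### Computable predicates and functions -/

/-- A type whose elements are coded by the numbers in some set of `M`. -/
class Code (M : Type*) [L2Structure M] (α : Type*) where
  code : α → M
  inj : Injective code
  range_mem : Set.range code ∈ L2Structure.sets (M := M)

section Model

variable {M : Type*} [L2Structure M]

@[simp] theorem NumTerm.eval_pair (s t : NumTerm) (v : ℕ → M) :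
    (NumTerm.pair s t).eval v = SOArith.pair (s.eval v) (t.eval v) := rfl

theorem L2Formula.realize_bex {x y : ℕ} {φ : L2Formula} {v : ℕ → M}
    {V : ℕ → L2Structure.sets (M := M)} :
    (L2Formula.bex x y φ).Realize v V ↔
      ∃ a, a < update v x a y + 1 ∧ φ.Realize (update v x a) V := by
  simp [L2Formula.bex, Realize, NumTerm.eval]

theorem L2Formula.realize_ball {x y : ℕ} {φ : L2Formula} {v : ℕ → M}
    {V : ℕ → L2Structure.sets (M := M)} :
    (L2Formula.ball x y φ).Realize v V ↔
      ∀ a, a < update v x a y + 1 → φ.Realize (update v x a) V := by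
  simp [L2Formula.ball, Realize, NumTerm.eval]

open Code

variable {α β γ : Type*} [Code M α] [Code M β] [Code M γ]

variable (M) in
/-- The set of codes of elements that satisfy `P`. -/
def codes (P : α → Prop) : Set M := {p | ∃ a, P a ∧ code a = p}

variable (M) in
/-- `P` is decidable in `M`: the set of codes of its elements belongs to `M`. -/
def RecP (P : α → Prop) : Prop := codes M P ∈ L2Structure.sets (M := M)

theorem code_mem_codes {P : α → Prop} {a : α} : code a ∈ codes M P ↔ P a :=
  ⟨fun ⟨_, hb, h⟩ => inj h ▸ hb, fun h => ⟨a, h, rfl⟩⟩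

theorem RecP.of_iff {P Q : α → Prop} (hP : RecP M P) (h : ∀ a, P a ↔ Q a) : RecP M Q := by
  rwa [funext fun a => propext (h a)] at hP

variable (M) in
/-- The set of codes of pairs `(a, f a)`. -/
def graphCodes (f : α → β) : Set M := {p | ∃ a, p = pair (code a) (code (f a))}

theorem mem_graphCodes {f : α → β} {p : M} :
    p ∈ graphCodes M f ↔ ∃ a, p = pair (code a) (code (f a)) := Iff.rfl

variable [hM : Fact (IsModelRCA0 M)]

instance : Code M M where
  code := id
  inj := injective_id
  range_mem := by rw [Set.range_id]; exact sets_univ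

@[simp] theorem code_self (a : M) : (code a : M) = a := rfl

/-- Both components are bounded by the code of the pair, so bounded quantifiers suffice. The same
device serves most of the closure properties below. -/
theorem sets_prod {A B : Set M} (hA : A ∈ L2Structure.sets (M := M))
    (hB : B ∈ L2Structure.sets (M := M)) :
    {p | ∃ a ∈ A, ∃ b ∈ B, p = pair a b} ∈ L2Structure.sets (M := M) := by
  convert sigma00_comprehension (M := M) (.bexVar 1 0 (.bexVar 2 0 (.and (.and (.mem (.var 1) 0)
    (.mem (.var 2) 1)) (.eq (.var 0) (.pair (.var 1) (.var 2)))))) 0 (fun _ => 0) (setAssign ⟨A, hA⟩ ⟨B, hB⟩ ⟨B, hB⟩) using 1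
  ext p
  simp [realize_bex, Realize, NumTerm.eval, setAssign, lt_add_one_iff]
  constructor
  · rintro ⟨a, ha, b, hb, rfl⟩
    exact ⟨a, left_le_pair a b, b, right_le_pair a b, ⟨ha, hb⟩, rfl⟩
  · rintro ⟨a, -, b, -, ⟨ha, hb⟩, rfl⟩
    exact ⟨a, ha, b, hb, rfl⟩

instance : Code M (α × β) where
  code p := pair (code p.1) (code p.2)
  inj p q h := Prod.ext (inj (pair_inj.1 h).1) (inj (pair_inj.1 h).2)
  range_mem := by
    convert sets_prod (range_mem (M := M) (α := α)) (range_mem (M := M) (α := β)) using 1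
    ext p
    simp [eq_comm]

@[simp] theorem code_prod (p : α × β) : (code p : M) = pair (code p.1) (code p.2) := rfl

variable (M) in
/-- `f` is computable in `M`: its graph is decidable in `M`. -/
def Rec (f : α → β) : Prop := graphCodes M f ∈ L2Structure.sets (M := M)

theorem pair_code_mem {P : α × β → Prop} {a : α} {b : β} :
    pair (code a) (code b) ∈ codes M P ↔ P (a, b) :=
  code_mem_codes (a := (a, b))

theorem pair_mem_graphCodes {f : α → β} {x y : M} :
    pair x y ∈ graphCodes M f ↔ ∃ a, x = code a ∧ y = code (f a) := by
  simp only [mem_graphCodes, pair_inj]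

theorem graphCodes_eq {f : α → β} :
    graphCodes M f = codes M (fun p : α × β => f p.1 = p.2) := by
  ext p
  constructor
  · rintro ⟨a, rfl⟩
    exact ⟨(a, f a), rfl, rfl⟩
  · rintro ⟨⟨a, b⟩, h, rfl⟩
    exact ⟨a, by rw [show f a = b from h]; rfl⟩

theorem Rec.of_graph {f : α → β} (h : RecP M (fun p : α × β => f p.1 = p.2)) : Rec M f := by
  rwa [Rec, graphCodes_eq]

theorem recP_iff {P : M → Prop} : RecP M P ↔ {n | P n} ∈ L2Structure.sets (M := M) := by
  simp [RecP, codes]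

/-! ### Closure properties of decidable predicates and computable functions -/

theorem RecP.not {P : α → Prop} (hP : RecP M P) : RecP M (fun a => ¬ P a) := by
  unfold RecP
  convert sigma00_comprehension (M := M) (.and (.mem (.var 0) 0) (.neg (.mem (.var 0) 1)))
    0 (fun _ => 0) (setAssign ⟨_, range_mem (M := M) (α := α)⟩ ⟨_, hP⟩ ⟨_, hP⟩) using 1
  ext p
  simp only [Realize, NumTerm.eval, setAssign, update_self, Set.mem_ofPred_eq]
  constructor
  · rintro ⟨a, ha, rfl⟩
    exact ⟨⟨a, rfl⟩, by rwa [code_mem_codes]⟩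
  · rintro ⟨⟨a, rfl⟩, ha⟩
    exact ⟨a, by rwa [code_mem_codes] at ha, rfl⟩

theorem RecP.and {P Q : α → Prop} (hP : RecP M P) (hQ : RecP M Q) :
    RecP M (fun a => P a ∧ Q a) := by
  unfold RecP
  convert sigma00_comprehension (M := M) (.and (.mem (.var 0) 0) (.mem (.var 0) 1))
    0 (fun _ => 0) (setAssign ⟨_, hP⟩ ⟨_, hQ⟩ ⟨_, hQ⟩) using 1
  ext p
  simp only [Realize, NumTerm.eval, setAssign, update_self, Set.mem_ofPred_eq]
  constructor
  · rintro ⟨a, ⟨ha, ha'⟩, rfl⟩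
    exact ⟨code_mem_codes.2 ha, code_mem_codes.2 ha'⟩
  · rintro ⟨⟨a, ha, rfl⟩, ha'⟩
    exact ⟨a, ⟨ha, code_mem_codes.1 ha'⟩, rfl⟩

theorem RecP.or {P Q : α → Prop} (hP : RecP M P) (hQ : RecP M Q) :
    RecP M (fun a => P a ∨ Q a) :=
  (hP.not.and hQ.not).not.of_iff fun a => by tauto

theorem RecP.imp {P Q : α → Prop} (hP : RecP M P) (hQ : RecP M Q) :
    RecP M (fun a => P a → Q a) :=
  (hP.and hQ.not).not.of_iff fun a => by tauto

/-- The value `f a` is not bounded in terms of `a`, so this needs Δ⁰₁ comprehension: some value of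
`f` at `a` satisfies `P`, equivalently all do. -/
theorem RecP.comp {P : β → Prop} {f : α → β} (hP : RecP M P) (hf : Rec M f) :
    RecP M (fun a => P (f a)) := by
  unfold RecP
  have := delta01_comprehension (M := M)
    (.and (.mem (.pair (.var 0) (.var 1)) 0) (.mem (.var 1) 1))
    -- The universal form would hold vacuously at numbers that code nothing, hence the extra
    -- conjunct.
    (.and (.mem (.var 0) 2) (.imp (.mem (.pair (.var 0) (.var 1)) 0) (.mem (.var 1) 1)))
    0 1 (fun _ => 0) (setAssign ⟨_, hf⟩ ⟨_, hP⟩ ⟨_, range_mem (M := M) (α := α)⟩)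
  simp only [Realize, NumTerm.eval_pair, NumTerm.eval, update_self, ne_eq, zero_ne_one,
    not_false_eq_true, update_of_ne, setAssign, pair_mem_graphCodes, Set.mem_range] at this
  convert this ?_ using 1
  · ext p
    constructor
    · rintro ⟨a, ha, rfl⟩
      exact ⟨_, ⟨a, rfl, rfl⟩, code_mem_codes.2 ha⟩
    · rintro ⟨_, ⟨a, rfl, rfl⟩, h⟩
      exact ⟨a, code_mem_codes.1 h, rfl⟩
  · intro n
    constructor
    · rintro ⟨_, ⟨a, rfl, rfl⟩, h⟩
      refine fun d => ⟨⟨a, rfl⟩, ?_⟩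
      rintro ⟨a', h', rfl⟩
      exact inj h' ▸ h
    · intro h
      obtain ⟨a, rfl⟩ := (h 0).1
      exact ⟨_, ⟨a, rfl, rfl⟩, (h _).2 ⟨a, rfl, rfl⟩⟩

theorem Rec.fst : Rec M (Prod.fst : α × β → α) := by
  unfold Rec
  convert sigma00_comprehension (M := M) (.bexVar 1 0 (.bexVar 2 0
    (.and (.mem (.pair (.var 1) (.var 2)) 0)
      (.eq (.var 0) (.pair (.pair (.var 1) (.var 2)) (.var 1)))))) 0 (fun _ => 0)
      (fun _ => ⟨_, range_mem (M := M) (α := α × β)⟩) using 1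
  ext p
  simp [realize_bex, Realize, NumTerm.eval, lt_add_one_iff, mem_graphCodes]
  constructor
  · rintro ⟨a, b, rfl⟩
    exact ⟨_, right_le_pair _ _, _, (right_le_pair _ _).trans (left_le_pair _ _), ⟨a, b, rfl⟩, rfl⟩
  · rintro ⟨_, -, _, -, ⟨a, b, h⟩, rfl⟩
    obtain ⟨rfl, rfl⟩ := pair_inj.1 h
    exact ⟨a, b, rfl⟩

theorem Rec.snd : Rec M (Prod.snd : α × β → β) := by
  unfold Rec
  convert sigma00_comprehension (M := M) (.bexVar 1 0 (.bexVar 2 0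
    (.and (.mem (.pair (.var 1) (.var 2)) 0)
      (.eq (.var 0) (.pair (.pair (.var 1) (.var 2)) (.var 2)))))) 0 (fun _ => 0)
      (fun _ => ⟨_, range_mem (M := M) (α := α × β)⟩) using 1
  ext p
  simp [realize_bex, Realize, NumTerm.eval, lt_add_one_iff, mem_graphCodes]
  constructor
  · rintro ⟨a, b, rfl⟩
    exact ⟨_, (left_le_pair _ _).trans (left_le_pair _ _), _, right_le_pair _ _, ⟨a, b, rfl⟩, rfl⟩
  · rintro ⟨_, -, _, -, ⟨a, b, h⟩, rfl⟩
    obtain ⟨rfl, rfl⟩ := pair_inj.1 h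
    exact ⟨a, b, rfl⟩

theorem Rec.code : Rec M (code : α → M) := by
  unfold Rec
  convert sigma00_comprehension (M := M) (.bexVar 1 0 (.and (.mem (.var 1) 0)
    (.eq (.var 0) (.pair (.var 1) (.var 1))))) 0 (fun _ => 0)
      (fun _ => ⟨_, range_mem (M := M) (α := α)⟩) using 1
  ext p
  simp [realize_bex, Realize, NumTerm.eval, lt_add_one_iff, mem_graphCodes]
  exact exists_congr fun a => ⟨fun h => ⟨h ▸ left_le_pair _ _, h⟩, fun h => h.2⟩

theorem Rec.const (b : β) : Rec M (fun _ : α => b) := by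
  unfold Rec
  convert sigma00_comprehension (M := M) (.bexVar 1 0 (.and (.mem (.var 1) 0)
    (.eq (.var 0) (.pair (.var 1) (.var 2))))) 0
      (fun _ => Code.code b) (fun _ => ⟨_, range_mem (M := M) (α := α)⟩) using 1
  ext p
  simp [realize_bex, Realize, NumTerm.eval, lt_add_one_iff, mem_graphCodes]
  exact exists_congr fun a => ⟨fun h => ⟨h ▸ left_le_pair _ _, h⟩, fun h => h.2⟩

theorem Rec.pair {f : α → β} {g : α → γ} (hf : Rec M f) (hg : Rec M g) :
    Rec M (fun a => (f a, g a)) := by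
  unfold Rec
  convert sigma00_comprehension (M := M) (.bexVar 1 0 (.bexVar 2 0 (.bexVar 3 0 (.and
    (.and (.mem (.pair (.var 1) (.var 2)) 0) (.mem (.pair (.var 1) (.var 3)) 1))
    (.eq (.var 0) (.pair (.var 1) (.pair (.var 2) (.var 3)))))))) 0 (fun _ => 0)
      (setAssign ⟨_, hf⟩ ⟨_, hg⟩ ⟨_, hg⟩) using 1
  ext p
  simp only [realize_bex, Realize, NumTerm.eval_pair, NumTerm.eval, lt_add_one_iff, setAssign,
    update_self, ne_eq, zero_ne_one, OfNat.zero_ne_ofNat, OfNat.one_ne_ofNat, Nat.reduceEqDiff, not_false_eq_true, update_of_ne,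
    pair_mem_graphCodes, Set.mem_ofPred_eq]
  constructor
  · rintro ⟨a, rfl⟩
    exact ⟨_, left_le_pair _ _, _, (left_le_pair _ _).trans (right_le_pair _ _), _,
      (right_le_pair _ _).trans (right_le_pair _ _), ⟨⟨a, rfl, rfl⟩, a, rfl, rfl⟩, rfl⟩
  · rintro ⟨_, -, _, -, _, -, ⟨⟨a, rfl, rfl⟩, a', h, rfl⟩, rfl⟩
    obtain rfl := inj h
    exact ⟨a, rfl⟩

theorem Rec.comp {g : β → γ} {f : α → β} (hg : Rec M g) (hf : Rec M f) :
    Rec M (fun a => g (f a)) := by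
  unfold Rec
  have := delta01_comprehension (M := M)
    (.bexVar 2 0 (.bexVar 3 0 (.and (.eq (.var 0) (.pair (.var 2) (.var 3)))
      (.and (.mem (.pair (.var 2) (.var 1)) 0) (.mem (.pair (.var 1) (.var 3)) 1)))))
    (.and (.mem (.var 0) 2) (.ballVar 2 0 (.ballVar 3 0 (.imp (.eq (.var 0)
      (.pair (.var 2) (.var 3)))
        (.imp (.mem (.pair (.var 2) (.var 1)) 0) (.mem (.pair (.var 1) (.var 3)) 1))))))
    0 1 (fun _ => 0) (setAssign ⟨_, hf⟩ ⟨_, hg⟩ ⟨_, range_mem (M := M) (α := α × γ)⟩)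
  simp only [realize_bex, realize_ball, Realize, NumTerm.eval_pair, NumTerm.eval, lt_add_one_iff, setAssign,
    update_self, ne_eq, zero_ne_one, OfNat.zero_ne_ofNat, OfNat.one_ne_ofNat, Nat.reduceEqDiff, not_false_eq_true, update_of_ne,
    pair_mem_graphCodes, Set.mem_range, Prod.exists, code_prod] at this
  convert this ?_ using 1
  · ext p
    simp only [mem_graphCodes]
    constructor
    · rintro ⟨a, rfl⟩
      exact ⟨_, _, left_le_pair _ _, _, right_le_pair _ _, rfl, ⟨a, rfl, rfl⟩, ⟨_, rfl, rfl⟩⟩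
    · rintro ⟨_, _, -, _, -, rfl, ⟨a, rfl, rfl⟩, ⟨b, h, rfl⟩⟩
      obtain rfl := inj h
      exact ⟨a, rfl⟩
  · intro n
    constructor
    · rintro ⟨_, _, -, _, -, rfl, ⟨a, rfl, rfl⟩, ⟨b, h, rfl⟩⟩
      obtain rfl := inj h
      refine fun y => ⟨⟨_, _, rfl⟩, ?_⟩
      rintro _ - _ - h' ⟨a', rfl, rfl⟩
      obtain ⟨haa, rfl⟩ := pair_inj.1 h'
      obtain rfl := inj haa
      exact ⟨_, rfl, rfl⟩
    · intro h
      obtain ⟨a, c, rfl⟩ := (h 0).1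
      exact ⟨Code.code (f a), _, left_le_pair _ _, _, right_le_pair _ _, rfl, ⟨a, rfl, rfl⟩,
        (h _).2 _ (left_le_pair _ _) _ (right_le_pair _ _) rfl ⟨a, rfl, rfl⟩⟩

theorem Rec.add_prod : Rec M (fun p : M × M => p.1 + p.2) := by
  unfold Rec
  convert sigma00_comprehension (M := M) (.bexVar 1 0 (.bexVar 2 0
    (.eq (.var 0) (.pair (.pair (.var 1) (.var 2)) (.add (.var 1) (.var 2)))))) 0 (fun _ => 0)
      univAssign using 1
  ext p
  simp [realize_bex, Realize, NumTerm.eval, lt_add_one_iff, mem_graphCodes]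
  constructor
  · rintro ⟨a, b, rfl⟩
    exact ⟨_, (left_le_pair _ _).trans (left_le_pair _ _), _,
      (right_le_pair _ _).trans (left_le_pair _ _), rfl⟩
  · rintro ⟨_, -, _, -, rfl⟩
    exact ⟨_, _, rfl⟩

theorem Rec.mul_prod : Rec M (fun p : M × M => p.1 * p.2) := by
  unfold Rec
  convert sigma00_comprehension (M := M) (.bexVar 1 0 (.bexVar 2 0
    (.eq (.var 0) (.pair (.pair (.var 1) (.var 2)) (.mul (.var 1) (.var 2)))))) 0 (fun _ => 0)
      univAssign using 1
  ext p
  simp [realize_bex, Realize, NumTerm.eval, lt_add_one_iff, mem_graphCodes]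
  constructor
  · rintro ⟨a, b, rfl⟩
    exact ⟨_, (left_le_pair _ _).trans (left_le_pair _ _), _,
      (right_le_pair _ _).trans (left_le_pair _ _), rfl⟩
  · rintro ⟨_, -, _, -, rfl⟩
    exact ⟨_, _, rfl⟩

theorem recP_eq_prod : RecP M (fun p : α × α => p.1 = p.2) := by
  unfold RecP
  convert sigma00_comprehension (M := M) (.bexVar 1 0 (.and (.mem (.var 1) 0)
    (.eq (.var 0) (.pair (.var 1) (.var 1))))) 0 (fun _ => 0)
      (fun _ => ⟨_, range_mem (M := M) (α := α)⟩) using 1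
  ext p
  simp [realize_bex, Realize, NumTerm.eval, lt_add_one_iff, codes]
  constructor
  · rintro ⟨a, rfl⟩
    exact ⟨_, left_le_pair _ _, rfl⟩
  · rintro ⟨a, -, rfl⟩
    exact ⟨a, rfl⟩

theorem recP_lt_prod : RecP M (fun p : M × M => p.1 < p.2) := by
  unfold RecP
  convert sigma00_comprehension (M := M) (.bexVar 1 0 (.bexVar 2 0 (.and (.lt (.var 1) (.var 2))
    (.eq (.var 0) (.pair (.var 1) (.var 2)))))) 0 (fun _ => 0) univAssign using 1
  ext p
  simp [realize_bex, Realize, NumTerm.eval, lt_add_one_iff, codes]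
  constructor
  · rintro ⟨a, b, h, rfl⟩
    exact ⟨_, left_le_pair _ _, _, right_le_pair _ _, h, rfl⟩
  · rintro ⟨_, -, _, -, h, rfl⟩
    exact ⟨_, _, h, rfl⟩

theorem RecP.ball_le_prod {P : α × M → Prop} (hP : RecP M P) :
    RecP M (fun p : α × M => ∀ y ≤ p.2, P (p.1, y)) := by
  unfold RecP
  convert sigma00_comprehension (M := M) (.bexVar 1 0 (.bexVar 2 0 (.and (.mem (.var 1) 1)
    (.and (.eq (.var 0) (.pair (.var 1) (.var 2)))
      (.ballVar 3 2 (.mem (.pair (.var 1) (.var 3)) 0))))))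
      0 (fun _ => 0) (setAssign ⟨_, hP⟩ ⟨_, range_mem (M := M) (α := α)⟩ ⟨_, hP⟩) using 1
  ext p
  simp only [realize_bex, realize_ball, Realize, NumTerm.eval_pair, NumTerm.eval, lt_add_one_iff, setAssign,
    update_self, ne_eq, zero_ne_one, OfNat.zero_ne_ofNat, OfNat.one_ne_ofNat, Nat.reduceEqDiff, not_false_eq_true, update_of_ne, Set.mem_ofPred_eq, Set.mem_range]
  constructor
  · rintro ⟨⟨a, b⟩, h, rfl⟩
    exact ⟨_, left_le_pair _ _, _, right_le_pair _ _, ⟨a, rfl⟩, rfl,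
      fun y hy => pair_code_mem.2 (h y hy)⟩
  · rintro ⟨_, -, n, -, ⟨a, rfl⟩, rfl, h⟩
    exact ⟨(a, n), fun y hy => pair_code_mem.1 (h y hy), rfl⟩

theorem RecP.delta01 {P Q : α × β → Prop} (hP : RecP M P) (hQ : RecP M Q)
    (h : ∀ a, (∃ b, P (a, b)) ↔ ∀ b, Q (a, b)) : RecP M (fun a => ∃ b, P (a, b)) := by
  unfold RecP
  have := delta01_comprehension (M := M) (.mem (.pair (.var 0) (.var 1)) 0)
    -- Using the complement of `Q` makes witnesses that code nothing harmless in the universal form.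
    (.and (.mem (.var 0) 2) (.neg (.mem (.pair (.var 0) (.var 1)) 1)))
    0 1 (fun _ => 0) (setAssign ⟨_, hP⟩ ⟨_, hQ.not⟩ ⟨_, range_mem (M := M) (α := α)⟩)
  simp [Realize, NumTerm.eval, setAssign] at this
  convert this ?_ using 1
  · ext p
    constructor
    · rintro ⟨a, ⟨b, hb⟩, rfl⟩
      exact ⟨_, pair_code_mem.2 hb⟩
    · rintro ⟨_, ⟨⟨a, b⟩, hb, h⟩⟩
      obtain ⟨rfl, -⟩ := pair_inj.1 h
      exact ⟨a, ⟨b, hb⟩, rfl⟩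
  · intro n
    constructor
    · rintro ⟨_, ⟨⟨a, b⟩, hb, h'⟩⟩
      obtain ⟨rfl, -⟩ := pair_inj.1 h'
      refine fun y => ⟨⟨a, rfl⟩, ?_⟩
      rintro ⟨⟨a', b⟩, hb', h'⟩
      obtain ⟨h', -⟩ := pair_inj.1 h'
      obtain rfl := inj h'
      exact hb' ((h _).1 ⟨_, hb⟩ b)
    · intro h'
      obtain ⟨a, rfl⟩ := (h' 0).1
      obtain ⟨b, hb⟩ := (h a).2 fun b => by
        by_contra hb
        exact (h' (code b)).2 (pair_code_mem.2 hb)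
      exact ⟨_, pair_code_mem.2 hb⟩

theorem RecP.induction_ex {P : M × α → Prop} (hP : RecP M P) (zero : ∃ a, P (0, a))
    (succ : ∀ n, (∃ a, P (n, a)) → ∃ a, P (n + 1, a)) (n : M) : ∃ a, P (n, a) := by
  have := sigma01_induction (M := M) (.mem (.pair (.var 0) (.var 1)) 0)
    0 1 (fun _ => 0) (fun _ => ⟨_, hP⟩)
  simp only [Realize, NumTerm.eval_pair, NumTerm.eval, update_self, ne_eq, zero_ne_one,
    not_false_eq_true, update_of_ne] at this
  have key (n : M) : (∃ b, SOArith.pair n b ∈ codes M P) ↔ ∃ a, P (n, a) := by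
    constructor
    · rintro ⟨_, ⟨m, a⟩, h, h'⟩
      obtain ⟨rfl, -⟩ := pair_inj.1 h'
      exact ⟨a, h⟩
    · rintro ⟨a, h⟩
      exact ⟨_, ⟨(n, a), h, rfl⟩⟩
  simp only [key] at this
  exact this zero succ n

theorem RecP.induction {P : M → Prop} (hP : RecP M P) (zero : P 0)
    (succ : ∀ n, P n → P (n + 1)) (n : M) : P n := by
  have := RecP.induction_ex (P := fun p : M × M => P p.1) (hP.comp .fst)
  simp only [exists_const] at this
  exact this zero succ n

theorem Rec.add {f g : α → M} (hf : Rec M f) (hg : Rec M g) : Rec M (fun a => f a + g a) :=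
  Rec.add_prod.comp (hf.pair hg)

theorem Rec.mul {f g : α → M} (hf : Rec M f) (hg : Rec M g) : Rec M (fun a => f a * g a) :=
  Rec.mul_prod.comp (hf.pair hg)

theorem RecP.eq {f g : α → β} (hf : Rec M f) (hg : Rec M g) : RecP M (fun a => f a = g a) :=
  RecP.comp (P := fun p : β × β => p.1 = p.2) recP_eq_prod (hf.pair hg)

theorem RecP.lt {f g : α → M} (hf : Rec M f) (hg : Rec M g) : RecP M (fun a => f a < g a) :=
  RecP.comp (P := fun p : M × M => p.1 < p.2) recP_lt_prod (hf.pair hg)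

theorem RecP.le {f g : α → M} (hf : Rec M f) (hg : Rec M g) : RecP M (fun a => f a ≤ g a) :=
  (RecP.lt hg hf).not.of_iff fun _ => not_lt

theorem RecP.mem {A : Set M} (hA : A ∈ L2Structure.sets (M := M)) {f : α → M} (hf : Rec M f) :
    RecP M (fun a => f a ∈ A) :=
  RecP.comp (P := fun n : M => n ∈ A) (recP_iff.2 hA) hf

theorem Rec.pairing {f g : α → M} (hf : Rec M f) (hg : Rec M g) :
    Rec M (fun a => SOArith.pair (f a) (g a)) :=
  Rec.code.comp (hf.pair hg)

theorem RecP.ball {P : α → M → Prop} {f : α → M} (hP : RecP M (fun p : α × M => P p.1 p.2))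
    (hf : Rec M f) : RecP M (fun a => ∀ y ≤ f a, P a y) :=
  RecP.comp (P := fun p : α × M => ∀ y ≤ p.2, P p.1 y) (RecP.ball_le_prod hP)
    (f := fun a => (a, f a)) ((Rec.of_graph recP_eq_prod).pair hf)

theorem RecP.bex {P : α → M → Prop} {f : α → M} (hP : RecP M (fun p : α × M => P p.1 p.2))
    (hf : Rec M f) : RecP M (fun a => ∃ y ≤ f a, P a y) :=
  (RecP.ball (P := fun a y => ¬ P a y) hP.not hf).not.of_iff fun a => by push Not; rfl

/-! ### Least elements -/

theorem exists_least {P : M → Prop} (hP : RecP M P) (h : ∃ x, P x) :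
    ∃ x, P x ∧ ∀ y ≤ x, P y → y = x := by
  by_contra! hne
  obtain ⟨x, hx⟩ := h
  have hQ : RecP M (fun n => ∀ y ≤ n, ¬ P y) :=
    RecP.ball (P := fun _ y => ¬ P y) (hP.not.comp .snd) (.of_graph recP_eq_prod)
  refine hQ.induction ?_ (fun n ih y hy hPy => ?_) x x le_rfl hx
  · intro y hy hPy
    obtain ⟨z, hz, -, hzy⟩ := hne y hPy
    exact hzy ((hz.trans hy).antisymm zero_le |>.trans (hy.antisymm zero_le).symm)
  · obtain ⟨z, hz, hPz, hzy⟩ := hne y hPy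
    exact ih z (lt_add_one_iff.1 ((lt_of_le_of_ne hz hzy).trans_le hy)) hPz

/-- Minimality is a Π⁰₁ condition on `t`, so `exists_least` does not apply. If there were no
minimum, Σ⁰₁ induction would make `f` drop by any number `n` below `f i`, which is absurd for `n = f
i + 1`. -/
theorem exists_argmin {f : M → M} (hf : Rec M f) (i : M) : ∃ t ≥ i, ∀ l ≥ i, f t ≤ f l := by
  by_contra! h
  have hP : RecP M (fun p : M × M => i ≤ p.2 ∧ f p.2 + p.1 ≤ f i) :=
    (RecP.le (.const i) .snd).and
      (RecP.le ((hf.comp .snd).add .fst) (.const (f i)))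
  obtain ⟨t, -, ht⟩ := hP.induction_ex ⟨i, le_rfl, by simp⟩ (fun n ⟨t, hit, ht⟩ => by
    obtain ⟨l, hl, hlt⟩ := h t hit
    refine ⟨l, hl, le_trans ?_ ht⟩
    dsimp only
    rw [add_comm n, ← add_assoc]
    gcongr
    exact add_one_le_iff.2 hlt) (f i + 1)
  exact (lt_add_one_iff.2 le_rfl).not_ge (le_add_self.trans ht)

end Model

open Code

universe u

/-! ### Self-embeddings onto smaller parts of linear orders -/

section Model

variable {M : Type*} [L2Structure M]

section Descent

variable {R Q E : Set M}

/-- The set of those elements of `field R` that `E` maps to smaller elements. -/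
def descending (E R : Set M) : Set M := {x | ∃ y, pair x y ∈ E ∧ slt R y x}

theorem IsLinOrder.not_slt (hR : IsLinOrder R) {x y : M} (h : pair x y ∈ R) : ¬ slt R y x :=
  fun h' => h'.2 (hR.antisymm _ _ h'.1 h)

variable [hM : Fact (IsModelRCA0 M)]

theorem IsLinOrder.mem_field (hR : IsLinOrder R) {x y : M} (h : pair x y ∈ R) :
    x ∈ field R ∧ y ∈ field R := by
  obtain ⟨a, ha, b, hb, hab⟩ := hR.pairs _ h
  obtain ⟨rfl, rfl⟩ := pair_inj.1 hab
  exact ⟨ha, hb⟩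

theorem IsEmbedding.mem_field (hE : IsEmbedding E R Q) {x y : M} (h : pair x y ∈ E) :
    x ∈ field R ∧ y ∈ field Q := by
  obtain ⟨a, ha, b, hb, hab⟩ := hE.pairs _ h
  obtain ⟨rfl, rfl⟩ := pair_inj.1 hab
  exact ⟨ha, hb⟩

/-- As the embedding is total and single-valued on its field, being moved down is both Σ⁰₁ and Π⁰₁.
-/
theorem descending_mem_sets (hR : R ∈ L2Structure.sets (M := M))
    (hE : E ∈ L2Structure.sets (M := M)) (h : IsEmbedding E R Q) :
    descending E R ∈ L2Structure.sets (M := M) := by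
  have hslt : RecP M (fun p : M × M => slt R p.2 p.1) :=
    (RecP.mem hR (Rec.snd.pairing .fst)).and (RecP.eq .snd .fst).not
  have hEp : RecP M (fun p : M × M => pair p.1 p.2 ∈ E) := RecP.mem hE (Rec.fst.pairing .snd)
  refine recP_iff.1 (RecP.delta01 (hEp.and hslt)
    ((RecP.mem hR (Rec.fst.pairing .fst)).and (hEp.imp hslt)) fun x => ⟨?_, ?_⟩)
  · rintro ⟨y, hy, hyx⟩ z
    have hx := (h.mem_field hy).1
    refine ⟨hx, fun hz => ?_⟩
    rwa [(h.function x hx).unique hz hy]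
  · intro h'
    obtain ⟨y, hy, -⟩ := h.function x (h' 0).1
    exact ⟨y, hy, (h' y).2 hy⟩

/-- Induction on `n` yields a minimum of the part of `D` up to `n`; all quantifiers are bounded, so
the induction is available. -/
theorem IsLinOrder.exists_min_of_bounded (hR : IsLinOrder R) (hRm : R ∈ L2Structure.sets (M := M))
    {D : Set M} (hD : D ∈ L2Structure.sets (M := M)) (hDR : D ⊆ field R) {b : M}
    (hb : ∀ x ∈ D, x ≤ b) (hne : D.Nonempty) : ∃ x ∈ D, ∀ y ∈ D, pair x y ∈ R := by
  have hid : Rec M (fun n : M => n) := .of_graph recP_eq_prod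
  have hP : RecP M (fun n : M =>
      (∃ x ≤ n, x ∈ D) → ∃ x ≤ n, x ∈ D ∧ ∀ y ≤ n, y ∈ D → pair x y ∈ R) := by
    refine RecP.imp (RecP.bex (P := fun _ x => x ∈ D) (RecP.mem hD .snd) hid)
      (RecP.bex (P := fun n x => x ∈ D ∧ ∀ y ≤ n, y ∈ D → pair x y ∈ R) ?_ hid)
    exact (RecP.mem hD .snd).and (RecP.ball (P := fun (p : M × M) y => y ∈ D → pair p.2 y ∈ R)
      ((RecP.mem hD .snd).imp (RecP.mem hRm ((Rec.snd.comp .fst).pairing .snd))) .fst)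
  obtain ⟨x₀, hx₀⟩ := hne
  suffices h : ∀ n : M, (∃ x ≤ n, x ∈ D) → ∃ x ≤ n, x ∈ D ∧ ∀ y ≤ n, y ∈ D → pair x y ∈ R by
    obtain ⟨x, -, hx, h⟩ := h b ⟨x₀, hb _ hx₀, hx₀⟩
    exact ⟨x, hx, fun y hy => h y (hb y hy) hy⟩
  refine hP.induction ?_ fun n ih hn => ?_
  · rintro ⟨x, hx, hxD⟩
    refine ⟨x, hx, hxD, fun y hy _ => ?_⟩
    rw [hy.antisymm zero_le, hx.antisymm zero_le] at *
    exact hDR hxD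
  · have hle {y : M} (hy : y ≤ n + 1) : y ≤ n ∨ y = n + 1 := by
      rcases hy.lt_or_eq with h | h
      exacts [.inl (lt_add_one_iff.1 h), .inr h]
    have hn1 : n ≤ n + 1 := (lt_add_one_iff.2 le_rfl).le
    by_cases hex : ∃ x ≤ n, x ∈ D
    · obtain ⟨x, hxn, hx, h⟩ := ih hex
      by_cases hnx : n + 1 ∈ D ∧ pair (n + 1) x ∈ R
      · refine ⟨n + 1, le_rfl, hnx.1, fun y hy hyD => ?_⟩
        rcases hle hy with hy | rfl
        exacts [hR.trans _ _ _ hnx.2 (h y hy hyD), hDR hyD]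
      · refine ⟨x, hxn.trans hn1, hx, fun y hy hyD => ?_⟩
        rcases hle hy with hy | rfl
        · exact h y hy hyD
        · exact (hR.total _ (hDR hx) _ (hDR hyD)).resolve_right fun h => hnx ⟨hyD, h⟩
    · obtain ⟨x, hxn, hx⟩ := hn
      obtain rfl := (hle hxn).resolve_left fun h => hex ⟨x, h, hx⟩
      refine ⟨n + 1, le_rfl, hx, fun y hy hyD => ?_⟩
      obtain rfl := (hle hy).resolve_left fun h => hex ⟨y, h, hyD⟩
      exact hDR hx

/-- Applying the embedding to `E x < x` gives `E (E x) < E x`, so `E x` is again moved down. -/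
theorem exists_descending_slt (hR : IsLinOrder R) (hQR : Q ⊆ R) (h : IsEmbedding E R Q) {x : M}
    (hx : x ∈ descending E R) : ∃ y ∈ descending E R, slt R y x := by
  obtain ⟨y, hy, hyx⟩ := hx
  obtain ⟨z, hz, -⟩ := h.function y (hR.mem_field hyx.1).1
  have := h.strictMono _ _ _ _ hz hy hyx
  exact ⟨y, ⟨z, hz, hQR this.1, this.2⟩, hyx⟩

/-- Below each element that the embedding moves down there are arbitrarily large numbers which
the embedding moves down. -/
theorem exists_large_descending (hR : IsLinOrder R) (hRm : R ∈ L2Structure.sets (M := M))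
    (hEm : E ∈ L2Structure.sets (M := M)) (hQR : Q ⊆ R) (h : IsEmbedding E R Q) {x : M}
    (hx : x ∈ descending E R) (b : M) : ∃ y ∈ descending E R, pair y x ∈ R ∧ b < y := by
  -- Otherwise the moved-down elements below `x` form a bounded set, whose least element is moved
  -- further down within it. This avoids iterating the embedding.
  by_contra! hb
  have hD : {y | y ∈ descending E R ∧ pair y x ∈ R} ∈ L2Structure.sets (M := M) :=
    recP_iff.1 ((recP_iff.2 (descending_mem_sets hRm hEm h)).and
      (RecP.mem hRm ((Rec.of_graph recP_eq_prod).pairing (.const x))))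
  have hxx : pair x x ∈ R := (h.mem_field hx.choose_spec.1).1
  obtain ⟨y, hy, hmin⟩ := hR.exists_min_of_bounded hRm hD (fun y hy => (hR.mem_field hy.2).1)
    (fun y hy => hb y hy.1 hy.2) ⟨x, hx, hxx⟩
  obtain ⟨z, hz, hzy⟩ := exists_descending_slt hR hQR h hy.1
  exact hR.not_slt (hmin z ⟨hz, hR.trans _ _ _ hzy.1 hy.2⟩) hzy

end Descent

/-! ### The order of stages -/

variable [hM : Fact (IsModelRCA0 M)]

/-- `a` appears true at stage `b`: none of the values `f l` with `a < l ≤ b` is below `f a`. -/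
def AppearsTrue (f : M → M) (a b : M) : Prop := ∀ l ≤ b, a < l → f a < f l

/-- The strict order on stages in which `b` is below an earlier stage `a` if `a` appears true
at `b`, and above it otherwise. -/
def stageLt (f : M → M) (a b : M) : Prop :=
  (a < b ∧ ¬ AppearsTrue f a b) ∨ (b < a ∧ AppearsTrue f b a)

/-- The lexicographic order on nodes `(m, k)`, by the order of stages in the first component, and
decreasing in the second. -/
def nodeLe (f : M → M) (p q : M × M) : Prop := stageLt f p.1 q.1 ∨ (p.1 = q.1 ∧ q.2 ≤ p.2)

/-- The nodes of level above `i`. -/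
def IsNode (i : M) (p : M × M) : Prop := i < p.2 ∧ p.2 ≤ p.1

variable {f : M → M}

theorem AppearsTrue.mono {a b c : M} (h : AppearsTrue f a c) (hbc : b ≤ c) : AppearsTrue f a b :=
  fun l hl => h l (hl.trans hbc)

theorem AppearsTrue.trans {a b c : M} (hab : a < b) (h : AppearsTrue f a b)
    (h' : AppearsTrue f b c) : AppearsTrue f a c := by
  intro l hl hal
  rcases le_or_gt l b with hlb | hbl
  · exact h l hlb hal
  · exact (h b le_rfl hab).trans (h' l hl hbl)

theorem stageLt_irrefl (a : M) : ¬ stageLt f a a := by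
  simp [stageLt]

theorem stageLt_asymm {a b : M} (h : stageLt f a b) : ¬ stageLt f b a := by
  rintro (⟨h1, h2⟩ | ⟨h1, h2⟩) <;> rcases h with ⟨h3, h4⟩ | ⟨h3, h4⟩
  exacts [lt_asymm h1 h3, h2 h4, h4 h2, lt_asymm h1 h3]

theorem stageLt_total {a b : M} (h : a ≠ b) : stageLt f a b ∨ stageLt f b a := by
  unfold stageLt
  rcases lt_or_gt_of_ne h with h | h <;> tauto

/-- In a cycle with numerically least member `a`, this `a` appears true at `c` but not at `b`. If `b
< c`, truth at `c` persists back to `b`; if `c < b`, then `c` appears true at `b`, and so does `a`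
by transitivity. -/
theorem stageLt_acyclic_aux {a b c : M} (hab : a < b) (hac : a < c) (h : stageLt f a b)
    (h' : stageLt f b c) (h'' : stageLt f c a) : False := by
  obtain ⟨-, h⟩ := h.resolve_right fun h => lt_asymm h.1 hab
  obtain ⟨-, h''⟩ := h''.resolve_left fun h => lt_asymm h.1 hac
  rcases h' with ⟨hbc, -⟩ | ⟨hcb, h'⟩
  · exact h (h''.mono hbc.le)
  · exact h (h''.trans hac h')

/-- By totality a failure is a cycle of length three, which is rotated to start at its numerically
least member. -/
theorem stageLt_trans {a b c : M} (hab : stageLt f a b) (hbc : stageLt f b c) :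
    stageLt f a c := by
  have hne : a ≠ c := by
    rintro rfl
    exact stageLt_asymm hab hbc
  refine (stageLt_total hne).resolve_right fun hca => ?_
  have h1 : a ≠ b := by rintro rfl; exact stageLt_irrefl _ hab
  have h2 : b ≠ c := by rintro rfl; exact stageLt_irrefl _ hbc
  rcases lt_or_gt_of_ne h1 with h | h <;> rcases lt_or_gt_of_ne h2 with h' | h' <;>
    rcases lt_or_gt_of_ne hne with h'' | h''
  · exact stageLt_acyclic_aux h h'' hab hbc hca
  · exact (lt_asymm (h.trans h') h'').elim
  · exact stageLt_acyclic_aux h h'' hab hbc hca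
  · exact stageLt_acyclic_aux h'' h' hca hab hbc
  · exact stageLt_acyclic_aux h' h hbc hca hab
  · exact stageLt_acyclic_aux h' h hbc hca hab
  · exact (lt_asymm (h'.trans h) h'').elim
  · exact stageLt_acyclic_aux h'' h' hca hab hbc

theorem nodeLe_refl (p : M × M) : nodeLe f p p := .inr ⟨rfl, le_rfl⟩

theorem nodeLe_antisymm {p q : M × M} (h : nodeLe f p q) (h' : nodeLe f q p) : p = q := by
  rcases h with h | ⟨h1, h2⟩ <;> rcases h' with h' | ⟨h3, h4⟩
  · exact (stageLt_asymm h h').elim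
  · exact (stageLt_irrefl _ (h3 ▸ h)).elim
  · exact (stageLt_irrefl _ (h1 ▸ h')).elim
  · exact Prod.ext h1 (h4.antisymm h2)

theorem nodeLe_trans {p q r : M × M} (h : nodeLe f p q) (h' : nodeLe f q r) : nodeLe f p r := by
  rcases h with h | ⟨h1, h2⟩ <;> rcases h' with h' | ⟨h3, h4⟩
  · exact .inl (stageLt_trans h h')
  · exact .inl (h3 ▸ h)
  · exact .inl (h1 ▸ h')
  · exact .inr ⟨h1.trans h3, h4.trans h2⟩

theorem nodeLe_total (p q : M × M) : nodeLe f p q ∨ nodeLe f q p := by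
  by_cases h : p.1 = q.1
  · rcases le_total p.2 q.2 with h' | h'
    exacts [.inr (.inr ⟨h.symm, h'⟩), .inl (.inr ⟨h, h'⟩)]
  · rcases stageLt_total (f := f) h with h' | h'
    exacts [.inl (.inl h'), .inr (.inl h')]

/-- The code of the sequence of linear orders whose `i`-th entry consists of the nodes of level
above `i`. -/
def nodeOrders (f : M → M) : Set M :=
  codes M (fun x : ((M × M) × (M × M)) × M =>
    IsNode x.2 x.1.1 ∧ IsNode x.2 x.1.2 ∧ nodeLe f x.1.1 x.1.2)

theorem mem_entry_nodeOrders {i z : M} : z ∈ entry (nodeOrders f) i ↔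
    ∃ p q : M × M, z = pair (code p) (code q) ∧ IsNode i p ∧ IsNode i q ∧ nodeLe f p q := by
  constructor
  · rintro ⟨⟨⟨p, q⟩, i'⟩, h, h'⟩
    obtain ⟨rfl, rfl⟩ := pair_inj.1 h'
    exact ⟨p, q, rfl, h⟩
  · rintro ⟨p, q, rfl, h⟩
    exact ⟨((p, q), i), h, rfl⟩

theorem pair_mem_entry_nodeOrders {i : M} {p q : M × M} :
    pair (code p) (code q) ∈ entry (nodeOrders f) i ↔ IsNode i p ∧ IsNode i q ∧ nodeLe f p q := by
  rw [mem_entry_nodeOrders]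
  constructor
  · rintro ⟨p', q', h, h'⟩
    obtain ⟨hp, hq⟩ := pair_inj.1 h
    rwa [inj hp, inj hq]
  · exact fun h => ⟨p, q, rfl, h⟩

theorem mem_field_nodeOrders {i x : M} :
    x ∈ field (entry (nodeOrders f) i) ↔ ∃ p : M × M, x = code p ∧ IsNode i p := by
  constructor
  · intro h
    obtain ⟨p, q, h, hp, -⟩ := mem_entry_nodeOrders.1 h
    exact ⟨p, (pair_inj.1 h).1, hp⟩
  · rintro ⟨p, rfl, hp⟩
    exact pair_mem_entry_nodeOrders.2 ⟨hp, hp, nodeLe_refl p⟩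

theorem isLinOrder_nodeOrders (i : M) : IsLinOrder (entry (nodeOrders f) i) where
  pairs z hz := by
    obtain ⟨p, q, rfl, hp, hq, -⟩ := mem_entry_nodeOrders.1 hz
    exact ⟨_, mem_field_nodeOrders.2 ⟨p, rfl, hp⟩, _, mem_field_nodeOrders.2 ⟨q, rfl, hq⟩, rfl⟩
  antisymm a b hab hba := by
    obtain ⟨p, q, h, -, -, hpq⟩ := mem_entry_nodeOrders.1 hab
    obtain ⟨rfl, rfl⟩ := pair_inj.1 h
    rw [nodeLe_antisymm hpq (pair_mem_entry_nodeOrders.1 hba).2.2]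
  trans a b c hab hbc := by
    obtain ⟨p, q, h, hp, -, hpq⟩ := mem_entry_nodeOrders.1 hab
    obtain ⟨rfl, rfl⟩ := pair_inj.1 h
    obtain ⟨q', r, h', -, hr, hqr⟩ := mem_entry_nodeOrders.1 hbc
    obtain ⟨hq, rfl⟩ := pair_inj.1 h'
    obtain rfl := inj hq
    exact pair_mem_entry_nodeOrders.2 ⟨hp, hr, nodeLe_trans hpq hqr⟩
  total a ha b hb := by
    obtain ⟨p, rfl, hp⟩ := mem_field_nodeOrders.1 ha
    obtain ⟨q, rfl, hq⟩ := mem_field_nodeOrders.1 hb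
    simp only [pair_mem_entry_nodeOrders]
    exact (nodeLe_total p q).imp (fun h => ⟨hp, hq, h⟩) fun h => ⟨hq, hp, h⟩

/-! ### Decidability of the order of nodes -/

theorem recP_appearsTrue (hf : Rec M f) : RecP M (fun p : M × M => AppearsTrue f p.1 p.2) :=
  RecP.ball (P := fun (p : M × M) l => p.1 < l → f p.1 < f l)
    ((RecP.lt (Rec.fst.comp .fst) .snd).imp
      (RecP.lt (hf.comp (Rec.fst.comp .fst)) (hf.comp .snd))) .snd

theorem recP_nodeLe (hf : Rec M f) :
    RecP M (fun p : (M × M) × (M × M) => nodeLe f p.1 p.2) := by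
  have h1 : Rec M (fun p : (M × M) × (M × M) => p.1.1) := Rec.fst.comp .fst
  have h2 : Rec M (fun p : (M × M) × (M × M) => p.1.2) := Rec.snd.comp .fst
  have h3 : Rec M (fun p : (M × M) × (M × M) => p.2.1) := Rec.fst.comp .snd
  have h4 : Rec M (fun p : (M × M) × (M × M) => p.2.2) := Rec.snd.comp .snd
  have h5 := (recP_appearsTrue hf).comp (h1.pair h3)
  have h6 := (recP_appearsTrue hf).comp (h3.pair h1)
  exact (((RecP.lt h1 h3).and h5.not).or ((RecP.lt h3 h1).and h6)).or
    ((RecP.eq h1 h3).and (RecP.le h4 h2))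

theorem nodeOrders_mem_sets (hf : Rec M f) : nodeOrders f ∈ L2Structure.sets (M := M) := by
  have h1 : Rec M (fun x : ((M × M) × (M × M)) × M => x.1.1) := Rec.fst.comp .fst
  have h2 : Rec M (fun x : ((M × M) × (M × M)) × M => x.1.2) := Rec.snd.comp .fst
  exact ((RecP.lt .snd (Rec.snd.comp h1)).and (RecP.le (Rec.snd.comp h1) (Rec.fst.comp h1))).and
    (((RecP.lt .snd (Rec.snd.comp h2)).and (RecP.le (Rec.snd.comp h2) (Rec.fst.comp h2))).and
      ((recP_nodeLe hf).comp .fst))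

theorem entry_mem_sets {L : Set M} (hL : L ∈ L2Structure.sets (M := M)) (i : M) :
    entry L i ∈ L2Structure.sets (M := M) :=
  recP_iff.1 (RecP.mem hL ((Rec.of_graph recP_eq_prod).pairing (.const i)))

/-! ### Ranges of injections -/

/-- If `t` minimizes `f` above `j`, then all nodes of level above `j` are strictly below the node
`(t, j)`. -/
theorem nodeLe_of_isNode (hf : Injective f) {j t : M} (ht : ∀ l ≥ j, f t ≤ f l) (hjt : j ≤ t)
    {p : M × M} (hp : IsNode j p) : nodeLe f p (t, j) ∧ p ≠ (t, j) := by
  refine ⟨?_, fun h => (h ▸ hp.1).ne rfl⟩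
  rcases lt_trichotomy p.1 t with h | h | h
  -- A stage before `t` that carries a node of level above `j` is at least `j`, so `f t` refutes its
  -- apparent truth.
  · refine .inl (.inl ⟨h, fun h' => ?_⟩)
    exact (h' t le_rfl h).not_ge (ht _ (hp.1.le.trans hp.2))
  · exact .inr ⟨h, hp.1.le⟩
  -- By injectivity the minimum is strict after `t`, so `t` appears true at every later stage.
  · exact .inl (.inr ⟨h, fun l _ hl =>
      (ht l (hjt.trans hl.le)).lt_of_ne fun h' => hl.ne (hf h')⟩)

theorem range_mem_sets (hFC : FraisseConjecture M) (hf : Rec M f) (hinj : Injective f) :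
    Set.range f ∈ L2Structure.sets (M := M) := by
  obtain ⟨i, j, hij, E, hEm, hE⟩ := hFC _ (nodeOrders_mem_sets hf) isLinOrder_nodeOrders
  have hR : IsLinOrder (entry (nodeOrders f) i) := isLinOrder_nodeOrders i
  have hRm := entry_mem_sets (nodeOrders_mem_sets hf) i
  have hQR : entry (nodeOrders f) j ⊆ entry (nodeOrders f) i := by
    intro z hz
    obtain ⟨p, q, rfl, hp, hq, h⟩ := mem_entry_nodeOrders.1 hz
    exact pair_mem_entry_nodeOrders.2 ⟨⟨hij.trans hp.1, hp.2⟩, ⟨hij.trans hq.1, hq.2⟩, h⟩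
  set W := descending E (entry (nodeOrders f) i) with hW
  have hWm : W ∈ L2Structure.sets (M := M) := descending_mem_sets hRm hEm hE
  have hlarge (p : M × M) (hp : code p ∈ W) (b : M) :
      ∃ q : M × M, code q ∈ W ∧ nodeLe f q p ∧ b < q.1 := by
    -- The second component of a node is at most the first, so a code above `pair b b` forces a
    -- stage above `b`.
    obtain ⟨y, hy, hyp, hby⟩ := exists_large_descending hR hRm hEm hQR hE hp (pair b b)
    obtain ⟨q, rfl, hq⟩ := mem_field_nodeOrders.1 (hR.mem_field hyp).1
    refine ⟨q, hy, (pair_mem_entry_nodeOrders.1 hyp).2.2, ?_⟩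
    by_contra! h
    exact (pair_mono h (hq.2.trans h)).not_gt hby
  -- A node below `p` at a stage beyond `l` shows that `p.1` appears true there, hence at `l`.
  have htrue (p : M × M) (hp : code p ∈ W) (l : M) (hl : p.1 < l) : f p.1 < f l := by
    obtain ⟨q, -, hqp, hq⟩ := hlarge p hp l
    rcases hqp with (⟨h, -⟩ | ⟨h, h'⟩) | ⟨h, -⟩
    · exact (h.asymm (hl.trans hq)).elim
    · exact h' l hq.le hl
    · exact ((hl.trans hq).ne h.symm).elim
  have hne : ∃ p : M × M, code p ∈ W := by
    obtain ⟨t, hjt, ht⟩ := exists_argmin hf j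
    have htj : IsNode i (t, j) := ⟨hij, hjt⟩
    obtain ⟨y, hy, -⟩ := hE.function _ (mem_field_nodeOrders.2 ⟨(t, j), rfl, htj⟩)
    obtain ⟨p, rfl, hp⟩ := mem_field_nodeOrders.1 (hE.mem_field hy).2
    obtain ⟨hle, hpt⟩ := nodeLe_of_isNode hinj ht hjt hp
    exact ⟨(t, j), code p, hy,
      pair_mem_entry_nodeOrders.2 ⟨⟨hij.trans hp.1, hp.2⟩, htj, hle⟩, fun h => hpt (inj h)⟩
  -- Passing to a later stage in `W` strictly increases the value of `f`.
  have hunb : ∀ v : M, ∃ p : M × M, code p ∈ W ∧ v ≤ f p.1 := by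
    have hP : RecP M (fun x : M × (M × M) => code x.2 ∈ W ∧ x.1 ≤ f x.2.1) :=
      (RecP.mem hWm (Rec.code.comp .snd)).and (RecP.le .fst (hf.comp (Rec.fst.comp .snd)))
    refine hP.induction_ex (hne.imp fun p hp => ⟨hp, zero_le⟩) fun v ⟨p, hp, hv⟩ => ?_
    obtain ⟨q, hq, -, hpq⟩ := hlarge p hp p.1
    exact ⟨q, hq, add_one_le_iff.2 (hv.trans_lt (htrue p hp _ hpq))⟩
  -- `hQ` and `hQ'` supply the Σ⁰₁ and the Π⁰₁ definition of the range: some, or every, node of `W`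
  -- with value above `n` has `n` enumerated by its stage.
  have hQ : RecP M (fun x : M × (M × M) =>
      code x.2 ∈ W ∧ x.1 < f x.2.1 ∧ ∃ l ≤ x.2.1, f l = x.1) :=
    (RecP.mem hWm (Rec.code.comp .snd)).and ((RecP.lt .fst (hf.comp (Rec.fst.comp .snd))).and
      (RecP.bex (P := fun (x : M × (M × M)) l => f l = x.1)
        (RecP.eq (hf.comp .snd) (Rec.fst.comp .fst)) (Rec.fst.comp .snd)))
  have hQ' : RecP M (fun x : M × (M × M) =>
      code x.2 ∈ W → x.1 < f x.2.1 → ∃ l ≤ x.2.1, f l = x.1) :=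
    (RecP.mem hWm (Rec.code.comp .snd)).imp ((RecP.lt .fst (hf.comp (Rec.fst.comp .snd))).imp
      (RecP.bex (P := fun (x : M × (M × M)) l => f l = x.1)
        (RecP.eq (hf.comp .snd) (Rec.fst.comp .fst)) (Rec.fst.comp .snd)))
  have hlt (n : M) : ∃ p : M × M, code p ∈ W ∧ n < f p.1 :=
    (hunb (n + 1)).imp fun p hp => ⟨hp.1, add_one_le_iff.1 hp.2⟩
  have hmem (n l : M) (p : M × M) (hl : f l = n) (hp : code p ∈ W) (hn : n < f p.1) :
      ∃ l ≤ p.1, f l = n := by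
    refine ⟨l, ?_, hl⟩
    by_contra! h
    exact (htrue p hp l h).asymm (hl ▸ hn)
  refine recP_iff.1 ((RecP.delta01 hQ hQ' fun n => ?_).of_iff fun n => ?_)
  · constructor
    · rintro ⟨-, -, -, l, -, rfl⟩ p hp hn
      exact hmem _ l p rfl hp hn
    · intro h
      obtain ⟨p, hp, hn⟩ := hlt n
      exact ⟨p, hp, hn, h p hp hn⟩
  · constructor
    · rintro ⟨-, -, -, l, -, rfl⟩
      exact ⟨l, rfl⟩
    · rintro ⟨l, hl⟩
      obtain ⟨p, hp, hn⟩ := hlt n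
      exact ⟨p, hp, hn, hmem n l p hl hp hn⟩

/-! ### Arithmetical comprehension -/

theorem add_self_inj {a b : M} (h : a + a = b + b) : a = b := by
  rcases lt_trichotomy a b with h' | h' | h'
  exacts [((add_lt_add h' h').ne h).elim, h', ((add_lt_add h' h').ne h.symm).elim]

theorem add_self_ne_add_self_add_one (a b : M) : a + a ≠ b + b + 1 := by
  intro h
  rcases le_or_gt a b with h' | h'
  · exact (lt_add_one_iff.2 (add_le_add h' h')).ne h
  · refine (lt_of_lt_of_le ?_ (add_le_add (add_one_le_iff.2 h') (add_one_le_iff.2 h'))).ne h.symm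
    rw [add_add_add_comm, ← add_assoc]
    exact lt_add_one_iff.2 le_rfl

/-- A `Σ⁰₁` set is the preimage of the range of a computable injection under doubling. -/
theorem exists_injective_range {C : Set M} (hC : C ∈ L2Structure.sets (M := M)) :
    ∃ f : M → M, Rec M f ∧ Injective f ∧
      ∀ x, (∃ y, pair x y ∈ C) ↔ x + x ∈ Set.range f := by
  -- Only the least witness `y` for `x` counts, so at most one `p` is sent to `x + x`; every other
  -- `p` gets its own odd value.
  let S (p x y : M) : Prop := p = pair x y ∧ p ∈ C ∧ ∀ z ≤ y, pair x z ∈ C → z = y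
  let G (p q : M) : Prop := (∃ x ≤ p, ∃ y ≤ p, S p x y ∧ q = x + x) ∨
    (¬ ∃ x ≤ p, ∃ y ≤ p, S p x y) ∧ q = p + p + 1
  have hG (p : M) : ∃ q, G p q := by
    by_cases h : ∃ x ≤ p, ∃ y ≤ p, S p x y
    · obtain ⟨x, hx, y, hy, h⟩ := h
      exact ⟨x + x, .inl ⟨x, hx, y, hy, h, rfl⟩⟩
    · exact ⟨_, .inr ⟨h, rfl⟩⟩
  have hGu (p q q' : M) (h : G p q) (h' : G p q') : q = q' := by
    rcases h with ⟨x, hx, y, hy, h, rfl⟩ | ⟨h, rfl⟩ <;>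
    rcases h' with ⟨x', hx', y', hy', h', rfl⟩ | ⟨h', rfl⟩
    · obtain ⟨rfl, -⟩ := pair_inj.1 (h.1.symm.trans h'.1)
      rfl
    · exact (h' ⟨x, hx, y, hy, h⟩).elim
    · exact (h ⟨x', hx', y', hy', h'⟩).elim
    · rfl
  choose f hfG using hG
  have hS : RecP M (fun t : ((M × M) × M) × M => S t.1.1.1 t.1.2 t.2) := by
    have hp : Rec M (fun t : ((M × M) × M) × M => t.1.1.1) := (Rec.fst.comp .fst).comp .fst
    have hx : Rec M (fun t : ((M × M) × M) × M => t.1.2) := Rec.snd.comp .fst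
    exact (RecP.eq hp (hx.pairing .snd)).and ((RecP.mem hC hp).and
      (RecP.ball (P := fun (t : ((M × M) × M) × M) z => pair t.1.2 z ∈ C → z = t.2)
        ((RecP.mem hC ((hx.comp .fst).pairing .snd)).imp (RecP.eq .snd (Rec.snd.comp .fst))) .snd))
  have hGr : RecP M (fun t : M × M => G t.1 t.2) := by
    refine RecP.or ?_ (RecP.and (RecP.not ?_)
      (RecP.eq .snd ((Rec.fst.add .fst).add (.const 1))))
    · refine RecP.bex (P := fun (t : M × M) x => ∃ y ≤ t.1, S t.1 x y ∧ t.2 = x + x) ?_ .fst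
      refine RecP.bex (P := fun (t : (M × M) × M) y => S t.1.1 t.2 y ∧ t.1.2 = t.2 + t.2) ?_
        (Rec.fst.comp .fst)
      exact hS.and (RecP.eq ((Rec.snd.comp .fst).comp .fst)
        ((Rec.snd.comp .fst).add (Rec.snd.comp .fst)))
    · refine RecP.bex (P := fun (t : M × M) x => ∃ y ≤ t.1, S t.1 x y) ?_ .fst
      exact RecP.bex (P := fun (t : (M × M) × M) y => S t.1.1 t.2 y) hS (Rec.fst.comp .fst)
  refine ⟨f, .of_graph (hGr.of_iff fun t => ⟨fun h => hGu _ _ _ (hfG _) h, fun h => ?_⟩), ?_, ?_⟩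
  · exact h ▸ hfG t.1
  · intro p p' h
    have h1 := hfG p
    have h2 := hfG p'
    rw [← h] at h2
    rcases h1 with ⟨x, -, y, -, h1, e1⟩ | ⟨-, e1⟩ <;>
      rcases h2 with ⟨x', -, y', -, h2, e2⟩ | ⟨-, e2⟩
    · obtain rfl := add_self_inj (e1.symm.trans e2)
      -- Both are least witnesses for the same `x`, hence equal.
      rcases le_total y y' with hy | hy
      · rw [h1.1, h2.1, h2.2.2 y hy (h1.1 ▸ h1.2.1)]
      · rw [h1.1, h2.1, h1.2.2 y' hy (h2.1 ▸ h2.2.1)]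
    · exact (add_self_ne_add_self_add_one _ _ (e1.symm.trans e2)).elim
    · exact (add_self_ne_add_self_add_one _ _ (e2.symm.trans e1)).elim
    · exact add_self_inj (add_right_cancel (e1.symm.trans e2))
  · intro x
    constructor
    · intro h
      obtain ⟨y, hy, hmin⟩ := exists_least (P := fun y => pair x y ∈ C)
        (RecP.mem hC ((Rec.const x).pairing (.of_graph recP_eq_prod))) h
      exact ⟨pair x y, hGu _ _ _ (hfG _) (.inl ⟨x, left_le_pair x y, y, right_le_pair x y,
        ⟨rfl, hy, hmin⟩, rfl⟩)⟩
    · rintro ⟨p, hp⟩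
      rcases hfG p with ⟨x', -, y, -, h, e⟩ | ⟨-, e⟩
      · obtain rfl := add_self_inj (hp.symm.trans e)
        exact ⟨y, h.1 ▸ h.2.1⟩
      · exact (add_self_ne_add_self_add_one _ _ (hp.symm.trans e)).elim

/-- The projection is Σ⁰₁, so it is the preimage under doubling of the range of an injection, and
that range is in the model. -/
theorem RecP.ex {α β : Type*} [Code M α] [Code M β] (hFC : FraisseConjecture M)
    {P : α → β → Prop} (hP : RecP M (fun p : α × β => P p.1 p.2)) :
    RecP M (fun a => ∃ b, P a b) := by
  obtain ⟨f, hf, hinj, hrange⟩ := exists_injective_range hP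
  refine (RecP.mem (range_mem_sets hFC hf hinj) (Rec.code.add (Rec.code (α := α)))).of_iff
    fun a => ?_
  rw [← hrange]
  constructor
  · rintro ⟨_, ⟨a', b⟩, h, h'⟩
    obtain rfl := inj (pair_inj.1 h').1
    exact ⟨b, h⟩
  · rintro ⟨b, h⟩
    exact ⟨code b, (a, b), h, rfl⟩

theorem NumTerm.rec_eval {α : Type*} [Code M α] {g : α → ℕ → M}
    (hg : ∀ i, Rec M (fun a => g a i)) (t : NumTerm) : Rec M (fun a => t.eval (g a)) := by
  induction t with
  | var x => exact hg x
  | zero => exact .const 0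
  | one => exact .const 1
  | add s t hs ht => exact hs.add ht
  | mul s t hs ht => exact hs.mul ht

end Model

/-- The assignment depends on a parameter from an arbitrary coded type, since each quantifier adds a
coordinate and replaces `α` by `α × M`. Computability of each variable separately is enough. -/
theorem L2Formula.recP_realize {M : Type u} [L2Structure M] [hM : Fact (IsModelRCA0 M)]
    (hFC : FraisseConjecture M) {φ : L2Formula} (hφ : φ.IsArithmetical)
    (V : ℕ → L2Structure.sets (M := M)) {α : Type u} [Code M α] {g : α → ℕ → M}
    (hg : ∀ i, Rec M (fun a => g a i)) : RecP M (fun a => φ.Realize (g a) V) := by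
  have hupd {α : Type u} [Code M α] {g : α → ℕ → M} (hg : ∀ i, Rec M (fun a => g a i)) (x i : ℕ) :
      Rec M (fun p : α × M => update (g p.1) x p.2 i) := by
    by_cases h : i = x
    · subst h
      simpa only [update_self] using Rec.snd
    · simpa only [update_of_ne h] using (hg i).comp .fst
  induction φ generalizing α with
  | eq s t => exact RecP.eq (s.rec_eval hg) (t.rec_eval hg)
  | lt s t => exact RecP.lt (s.rec_eval hg) (t.rec_eval hg)
  | mem t X => exact RecP.mem (V X).2 (t.rec_eval hg)
  | neg φ h => exact (h hφ hg).not
  | and φ ψ h h' => exact (h hφ.1 hg).and (h' hφ.2 hg)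
  | or φ ψ h h' => exact (h hφ.1 hg).or (h' hφ.2 hg)
  | imp φ ψ h h' => exact (h hφ.1 hg).imp (h' hφ.2 hg)
  | allNum x φ h =>
    exact (RecP.ex hFC (P := fun a b => ¬ φ.Realize (update (g a) x b) V)
      (h hφ (hupd hg x)).not).not.of_iff fun a => not_exists_not
  | exNum x φ h =>
    exact RecP.ex hFC (P := fun a b => φ.Realize (update (g a) x b) V) (h hφ (hupd hg x))
  | allSet | exSet => exact hφ.elim

end SOArith

theorem mainTheorem4 (M : Type*) [SOArith.L2Structure M] (hRCA : SOArith.IsModelRCA0 M)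
    (hFC : SOArith.FraisseConjecture M) : SOArith.ArithmeticalComprehension M := by
  have : Fact (SOArith.IsModelRCA0 M) := ⟨hRCA⟩
  intro φ hφ x v V
  refine ⟨_, SOArith.recP_iff.1 (SOArith.L2Formula.recP_realize hFC hφ V
    (g := fun n : M => Function.update v x n) fun i => ?_), fun n => Iff.rfl⟩
  by_cases h : i = x
  · subst h
    simpa only [Function.update_self] using SOArith.Rec.of_graph SOArith.recP_eq_prod
  · simpa only [Function.update_of_ne h] using SOArith.Rec.const (v i)
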